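/- Let $\Theta\subset\mathbb{R}^d$ be compact and, for each $\theta\in\Theta$, let $\nu_\theta$ be a probability measure on the open interval $(0,1)$. Write $\rho(a)=(1-a)/a$ and, for $x,y\in\mathbb{N}=\{0,1,2,\dots\}$, $$\phi_\theta(x,y)=\log\int_0^1 a^{x+1}(1-a)^y\,d\nu_\theta(a).$$ Assume: (1) for all $\theta\in\Theta$, $\int|\log\rho|\,d\nu_\theta<\infty$ and $\int\log\rho\,d\nu_\theta<0$; (2) for all $\theta\in\Theta$, $\int\rho\,d\nu_\theta<1$; (3) for all $x,y\in\mathbb{N}$ the map $\theta\mapsto\phi_\theta(x,y)$ is continuous on $\Theta$; (4) for all $\theta,\theta'\in\Theta$, $\nu_\theta\ne\nu_{\theta'}$ if and only if $\theta\neq\theta'$; (5) $\inf_{\theta\in\Theta}\int\log(1-a)\,d\nu_\theta(a)>-\infty$. Let $\theta^\star\in\Theta$ be an interior point of $\Theta$. Let $\omega=(\omega_x)_{x\in\mathbb{Z}}$ be i.i.d. with law $\nu_{\theta^\star}$ and, given $\omega$, let $(X_t)_{t\in\mathbb{N}}$ be the Markov chain on $\mathbb{Z}$ with $X_0=0$ that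 jumps from $x$ to $x+1$ with probability $\omega_x$ and to $x-1$ with probability $1-\omega_x$; denote by $\mathbf{P}^\star$ the resulting (annealed) probability. Let $T_n=\inf\{t: X_t=n\}$, let $L_x^n=\#\{s<T_n: X_s=x,\ X_{s+1}=x-1\}$, and $$\ell_n(\theta)=\sum_{x=0}^{n-1}\phi_\theta(L_{x+1}^n,L_x^n).$$ Then the transition matrix $$Q(x,y)=\binom{x+y}{x}\int_0^1a^{x+1}(1-a)^y\,d\nu_{\theta^\star}(a),\qquad x,y\in\mathbb{N},$$ has a unique invariant probability measure $\pi^\star$ on $\mathbb{N}$. Let $(\tilde Z_k)_{k\in\mathbb{N}}$ be the stationary Markov chain with initial law $\pi^\star$ and transition matrix $Q$, so that $(\tilde Z_0,\tilde Z_1)=(x,y)$ with probability $\pi^\star(x)Q(x,y)$, and let $\mathbf{E}^\star$ denote expectation. (i) For every $\theta\in\Theta$, $\phi_\theta(\tilde Z_0,\tilde Z_1)$ is integrable, so that $\ell(\theta)=\mathbf{E}^\star[\phi_\theta(\tilde Z_0,\tilde Z_1)]$ is finite, and $$\frac1n\ell_n(\theta)\xrightarrow[n\to\infty]{}\ell(\theta)\quad\text{in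 }\mathbf{P}^\star\text{-probability}.$$ (ii) The convergence is locally uniform in the following sense: for every nonempty relatively open subset $U\subset\Theta$, $\sup_{\theta\in U}\phi_\theta(x,y)$ is finite for all $x,y\in\mathbb{N}$, $\sup_{\theta\in U}\phi_\theta(\tilde Z_0,\tilde Z_1)$ is integrable, and $$\frac1n\sum_{x=0}^{n-1}\sup_{\theta\in U}\phi_\theta(L_{x+1}^n,L_x^n)\xrightarrow[n\to\infty]{}\mathbf{E}^\star\Big[\sup_{\theta\in U}\phi_\theta(\tilde Z_0,\tilde Z_1)\Big]\quad\text{in }\mathbf{P}^\star\text{-probability}.$$ -/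

import Mathlib

open MeasureTheory ProbabilityTheory Filter Topology

namespace RWRE

noncomputable section

/-- An environment: the family `(ω_x)` of probabilities, in the open interval `(0,1)`, to step to
the right from each site `x ∈ ℤ`. -/
abbrev Env : Type := ℤ → Set.Ioo (0 : ℝ) 1

/-- The law `ν^{⊗ ℤ}` of an i.i.d. environment with marginal `ν`. -/
def envLaw (ν : Measure (Set.Ioo (0 : ℝ) 1)) : Measure Env :=
  Measure.infinitePi (fun _ : ℤ => ν)

/-- One-step transition probability from `x` to `y` of the walk in the fixed environment `e`. -/
def stepProb (e : Env) (x y : ℤ) : ℝ :=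
  if y = x + 1 then (e x : ℝ) else if y = x - 1 then 1 - (e x : ℝ) else 0

/-- Quenched probability `P_ω(X_0 = x_0, …, X_t = x_t)` for the walk started at `0`. -/
def quenchedPathProb (e : Env) (t : ℕ) (x : ℕ → ℤ) : ℝ :=
  if x 0 = 0 then ∏ s ∈ Finset.range t, stepProb e (x s) (x (s + 1)) else 0

/-- `X` is, under `P`, a nearest neighbour random walk on `ℤ` started at `0` in the random
environment `env`, which is i.i.d. with marginal `ν`: given the environment, `X` is the Markov
chain with transition probabilities `stepProb env`. The last field is the disintegration
`P(env ∈ A, X_0 = x_0, …, X_t = x_t) = ∫_A P_ω(X_0 = x_0, …, X_t = x_t) dν^{⊗ ℤ}(ω)`, so that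
the law of `X` under `P` is the annealed law. -/
structure IsRandomWalkInRandomEnv {Ω : Type*} [MeasurableSpace Ω] (P : Measure Ω)
    (ν : Measure (Set.Ioo (0 : ℝ) 1)) (env : Ω → Env) (X : ℕ → Ω → ℤ) : Prop where
  measurable_env : Measurable env
  measurable_walk : ∀ t, Measurable (X t)
  map_env : P.map env = envLaw ν
  quenched_law : ∀ (t : ℕ) (x : ℕ → ℤ) (A : Set Env), MeasurableSet A →
    P {o | env o ∈ A ∧ ∀ s ≤ t, X s o = x s} =
      ∫⁻ e in A, ENNReal.ofReal (quenchedPathProb e t x) ∂(envLaw ν)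

/-- First time at which the path `x` visits the site `n` (`0` by convention if it never does). -/
def hittingTime (x : ℕ → ℤ) (n : ℕ) : ℕ := sInf {t : ℕ | x t = (n : ℤ)}

/-- Number of left steps from the site `z` performed by the path `x` up to time `t`. -/
def leftSteps (x : ℕ → ℤ) (t : ℕ) (z : ℤ) : ℕ :=
  ((Finset.range t).filter (fun s => x s = z ∧ x (s + 1) = z - 1)).card

/-- `L_z^n`: number of left steps from `z` before the first visit to `n`. -/
def leftStepsUntilHit (x : ℕ → ℤ) (n : ℕ) (z : ℤ) : ℕ := leftSteps x (hittingTime x n) z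

/-- The moment `∫ a^{x+1} (1-a)^y dν(a)`. -/
def moment (ν : Measure (Set.Ioo (0 : ℝ) 1)) (x y : ℕ) : ℝ :=
  ∫ a, (a : ℝ) ^ (x + 1) * (1 - (a : ℝ)) ^ y ∂ν

/-- `φ(x,y) = log ∫ a^{x+1} (1-a)^y dν(a)`. -/
def phi (ν : Measure (Set.Ioo (0 : ℝ) 1)) (x y : ℕ) : ℝ := Real.log (moment ν x y)

/-- The criterion `ℓ_n = ∑_{x=0}^{n-1} φ(L_{x+1}^n, L_x^n)` evaluated on the path `x`. -/
def criterion (ν : Measure (Set.Ioo (0 : ℝ) 1)) (n : ℕ) (x : ℕ → ℤ) : ℝ :=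
  ∑ z ∈ Finset.range n,
    phi ν (leftStepsUntilHit x n ((z : ℤ) + 1)) (leftStepsUntilHit x n (z : ℤ))

/-- `ρ = (1-a)/a`. -/
def rho (a : Set.Ioo (0 : ℝ) 1) : ℝ := (1 - (a : ℝ)) / (a : ℝ)

/-- Transition probabilities `Q(x,y) = binom(x+y,x) ∫ a^{x+1} (1-a)^y dν(a)` of the branching
process with one immigrant per generation in an i.i.d. environment. -/
def transProb (ν : Measure (Set.Ioo (0 : ℝ) 1)) (x y : ℕ) : ℝ :=
  ((x + y).choose x : ℝ) * moment ν x y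

/-- The transition kernel on `ℕ` with transition probabilities `transProb ν`. -/
def branchingKernel (ν : Measure (Set.Ioo (0 : ℝ) 1)) : Kernel ℕ ℕ :=
  Kernel.ofFunOfCountable fun x =>
    Measure.sum fun y => ENNReal.ofReal (transProb ν x y) • Measure.dirac y

theorem branchingKernel_singleton (ν : Measure (Set.Ioo (0 : ℝ) 1)) (x y : ℕ) :
    branchingKernel ν x {y} = ENNReal.ofReal (transProb ν x y) := by
  change (Measure.sum fun y => ENNReal.ofReal (transProb ν x y) • Measure.dirac y) {y} = _
  rw [Measure.sum_apply _ (measurableSet_singleton y), tsum_eq_single y]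
  · simp
  · intro z hz
    simp [hz]

theorem integrable_moment (ν : Measure (Set.Ioo (0 : ℝ) 1)) [IsProbabilityMeasure ν] (x y : ℕ) :
    Integrable (fun a : Set.Ioo (0 : ℝ) 1 => (a : ℝ) ^ (x + 1) * (1 - (a : ℝ)) ^ y) ν := by
  refine Integrable.of_bound (C := 1) (Measurable.aestronglyMeasurable (by fun_prop)) ?_
  refine ae_of_all _ fun a => ?_
  have h0 : 0 ≤ (a : ℝ) := a.2.1.le
  have h1 : (a : ℝ) ≤ 1 := a.2.2.le
  have h2 : (0 : ℝ) ≤ 1 - a := by linarith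
  have h3 : 1 - (a : ℝ) ≤ 1 := by linarith
  rw [Real.norm_of_nonneg (by positivity)]
  exact mul_le_one₀ (pow_le_one₀ h0 h1) (by positivity) (pow_le_one₀ h2 h3)

instance (ν : Measure (Set.Ioo (0 : ℝ) 1)) [IsProbabilityMeasure ν] :
    IsMarkovKernel (branchingKernel ν) := by
  refine ⟨fun x => ⟨?_⟩⟩
  change (Measure.sum fun y => ENNReal.ofReal (transProb ν x y) • Measure.dirac y) Set.univ = 1
  rw [Measure.sum_apply _ MeasurableSet.univ]
  have key : ∀ y : ℕ, ENNReal.ofReal (transProb ν x y) =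
      ∫⁻ a : Set.Ioo (0 : ℝ) 1, ENNReal.ofReal
        (((x + y).choose x : ℝ) * ((a : ℝ) ^ (x + 1) * (1 - (a : ℝ)) ^ y)) ∂ν := by
    intro y
    rw [transProb, moment, ← integral_const_mul, ofReal_integral_eq_lintegral_ofReal]
    · exact (integrable_moment ν x y).const_mul _
    · refine ae_of_all _ fun a => ?_
      have h0 : 0 ≤ (a : ℝ) := a.2.1.le
      have h2 : (0 : ℝ) ≤ 1 - a := by linarith [a.2.2]
      simp only [Pi.zero_apply]
      positivity
  simp only [Measure.smul_apply, measure_univ, smul_eq_mul, mul_one, key]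
  rw [← lintegral_tsum (fun y => (Measurable.ennreal_ofReal (by fun_prop)).aemeasurable)]
  have one : ∀ a : Set.Ioo (0 : ℝ) 1, ∑' y : ℕ, ENNReal.ofReal
      (((x + y).choose x : ℝ) * ((a : ℝ) ^ (x + 1) * (1 - (a : ℝ)) ^ y)) = 1 := by
    intro a
    have h0 : 0 < (a : ℝ) := a.2.1
    have h2 : (0 : ℝ) < 1 - a := by linarith [a.2.2]
    have hs := hasSum_choose_mul_geometric_of_norm_lt_one (𝕜 := ℝ) x (r := 1 - (a : ℝ))
      (by rw [Real.norm_of_nonneg h2.le]; linarith)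
    have hs' := hs.mul_left ((a : ℝ) ^ (x + 1))
    have e1 : (a : ℝ) ^ (x + 1) * (1 / (1 - (1 - (a : ℝ))) ^ (x + 1)) = 1 := by
      rw [sub_sub_cancel]
      field_simp
    rw [e1] at hs'
    have hs2 : HasSum (fun y : ℕ => ((x + y).choose x : ℝ) *
        ((a : ℝ) ^ (x + 1) * (1 - (a : ℝ)) ^ y)) 1 := by
      have e2 : (fun y : ℕ => ((x + y).choose x : ℝ) * ((a : ℝ) ^ (x + 1) * (1 - (a : ℝ)) ^ y)) =
          fun y : ℕ => (a : ℝ) ^ (x + 1) * (((y + x).choose x : ℝ) * (1 - (a : ℝ)) ^ y) := by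
        funext y
        rw [add_comm x y]
        ring
      rw [e2]
      exact hs'
    rw [← ENNReal.ofReal_tsum_of_nonneg _ hs2.summable, hs2.tsum_eq, ENNReal.ofReal_one]
    intro y
    positivity
  rw [lintegral_congr one]
  simp

/-- Joint law of the first two states `(Z̃_0, Z̃_1)` of the Markov chain with initial law `π` and
transition kernel `branchingKernel ν`: mass `π(x) Q(x,y)` at `(x,y)`. -/
def pairLaw (π : Measure ℕ) (ν : Measure (Set.Ioo (0 : ℝ) 1)) : Measure (ℕ × ℕ) :=
  π ⊗ₘ branchingKernel ν

end

end RWRE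

namespace RWRE

open scoped ENNReal

/-! ### Lipschitz functions on `ℕ` -/

/-! Just before the walk first hits `n`, read the left-step counts from site `n` (where the count is
`0`) down to site `0`. Between two left steps from `x + 1` the walk must step right from `x`, and it
does so once more for the final crossing. So, given `k` left steps from `x + 1`, the left steps from
`x` are the failures before the `(k + 1)`-th success in trials of parameter `ω_x`. The backward
counts are therefore a Markov chain with kernel `Q` started at `0`, and the criterion is an additive
functional of this chain. Only upper bounds on probabilities of bad events are needed, so the proof
establishes domination (`measure_leftStepsVec_le`) instead of equality in law. It rests on a
quenched supermartingale (`completionProb_step`) and on the almost sure hitting of `n`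
(`ae_exists_eq`).

One more individual adds one geometric variable of mean `ρ`. Hence `Q` shrinks Lipschitz constants
by `m = ∫ ρ dν < 1` (`isContracting_branchingKernel`). Contraction gives existence and uniqueness of
the invariant law, its finite first moment, and means of additive functionals that stay within a
bounded distance of `n` times the stationary mean. From the latter, the second moment of a bounded
centred functional is `O(n)` (`exists_chainExp_sq_le`).

A functional with `|g x y| ≤ C (1 + x + y)` is truncated. Chebyshev's inequality handles the bounded
part, and Markov's inequality handles the remainder, whose stationary mean is small
(`tendstoInMeasure_average`). By Jensen's inequality `phi` obeys such a bound with a constant that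
does not depend on `θ` (`le_phi`), so its suprema over sets of parameters obey it too, and both
assertions follow from the same law of large numbers. -/

theorem abs_sub_le_of_increments {f : ℕ → ℝ} {L : ℝ} (hf : ∀ x, |f (x + 1) - f x| ≤ L) (x y : ℕ) :
    |f x - f y| ≤ L * ((x : ℝ) + y) := by
  have hL : 0 ≤ L := (abs_nonneg _).trans (hf 0)
  have key : ∀ x k : ℕ, |f (x + k) - f x| ≤ L * k := by
    intro x k
    induction k with
    | zero => simp
    | succ k ih =>
      have h := abs_add_le (f (x + (k + 1)) - f (x + k)) (f (x + k) - f x)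
      have h' := hf (x + k)
      rw [add_assoc] at h'
      rw [sub_add_sub_cancel] at h
      push_cast
      linarith
  rcases le_total y x with h | h
  · obtain ⟨k, rfl⟩ := Nat.exists_eq_add_of_le h
    refine (key y k).trans (mul_le_mul_of_nonneg_left ?_ hL)
    push_cast
    linarith [Nat.cast_nonneg (α := ℝ) y]
  · obtain ⟨k, rfl⟩ := Nat.exists_eq_add_of_le h
    rw [abs_sub_comm]
    refine (key x k).trans (mul_le_mul_of_nonneg_left ?_ hL)
    push_cast
    linarith [Nat.cast_nonneg (α := ℝ) x]

theorem abs_le_of_increments {f : ℕ → ℝ} {L : ℝ} (hf : ∀ x, |f (x + 1) - f x| ≤ L) (x : ℕ) :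
    |f x| ≤ |f 0| + L * x := by
  have h := abs_sub_le_of_increments hf x 0
  have h' := abs_add_le (f x - f 0) (f 0)
  simp only [sub_add_cancel, Nat.cast_zero, add_zero] at h h'
  linarith

theorem increments_of_abs_le {f : ℕ → ℝ} {B : ℝ} (hf : ∀ x, |f x| ≤ B) (x : ℕ) :
    |f (x + 1) - f x| ≤ 2 * B := by
  have := abs_sub (f (x + 1)) (f x)
  linarith [hf x, hf (x + 1)]

theorem integrable_of_increments {f : ℕ → ℝ} {L : ℝ} (hf : ∀ x, |f (x + 1) - f x| ≤ L)
    {μ : Measure ℕ} [IsFiniteMeasure μ] (hμ : Integrable (fun x : ℕ => (x : ℝ)) μ) :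
    Integrable f μ :=
  ((integrable_const (|f 0|)).add (hμ.const_mul L)).mono' (by fun_prop)
    (ae_of_all _ fun x => abs_le_of_increments hf x)

theorem integrable_of_abs_le {α : Type*} [MeasurableSpace α] [DiscreteMeasurableSpace α]
    {f : α → ℝ} {B : ℝ} (hf : ∀ x, |f x| ≤ B) (μ : Measure α) [IsFiniteMeasure μ] :
    Integrable f μ :=
  Integrable.of_bound (Measurable.of_discrete).aestronglyMeasurable B (ae_of_all _ hf)

theorem abs_integral_le {α : Type*} [MeasurableSpace α] {f : α → ℝ} {B : ℝ} (hf : ∀ x, |f x| ≤ B)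
    (μ : Measure α) [IsProbabilityMeasure μ] : |∫ x, f x ∂μ| ≤ B := by
  simpa using norm_integral_le_of_norm_le_const (μ := μ) (f := f) (ae_of_all _ hf)

theorem integrable_natCast_of_lintegral {μ : Measure ℕ} (h : ∫⁻ x, (x : ℝ≥0∞) ∂μ ≠ ∞) :
    Integrable (fun x : ℕ => (x : ℝ)) μ := by
  refine ⟨Measurable.of_discrete.aestronglyMeasurable, ?_⟩
  rw [hasFiniteIntegral_iff_ofReal (ae_of_all _ fun x => by positivity)]
  simpa using h.lt_top

theorem integral_bind {κ : Kernel ℕ ℕ} {μ : Measure ℕ} {f : ℕ → ℝ}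
    (hf : Integrable f (μ.bind κ)) : ∫ x, f x ∂(μ.bind κ) = ∫ x, ∫ y, f y ∂(κ x) ∂μ := by
  rw [Measure.comp_eq_comp_const_apply] at hf ⊢
  rw [Kernel.integral_comp hf]
  simp

/-- The Markov kernel `κ` on `ℕ` contracts the Wasserstein distance by the factor `m < 1`, and its
drift is at most `x ↦ m * (x + 1)`. -/
structure IsContracting (κ : Kernel ℕ ℕ) (m : ℝ) : Prop where
  nonneg : 0 ≤ m
  lt_one : m < 1
  lintegral_le : ∀ x : ℕ, ∫⁻ y, (y : ℝ≥0∞) ∂(κ x) ≤ ENNReal.ofReal (m * (x + 1))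
  increments : ∀ (f : ℕ → ℝ) (L : ℝ), (∀ x, |f (x + 1) - f x| ≤ L) →
    ∀ x, |∫ y, f y ∂(κ (x + 1)) - ∫ y, f y ∂(κ x)| ≤ m * L

namespace IsContracting

variable {κ : Kernel ℕ ℕ} {m : ℝ}

theorem integrable_natCast (h : IsContracting κ m) (x : ℕ) :
    Integrable (fun y : ℕ => (y : ℝ)) (κ x) :=
  integrable_natCast_of_lintegral ((h.lintegral_le x).trans_lt ENNReal.ofReal_lt_top).ne

theorem integral_le (h : IsContracting κ m) (x : ℕ) :
    ∫ y : ℕ, (y : ℝ) ∂(κ x) ≤ m * (x + 1) := by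
  have := h.nonneg
  rw [integral_eq_lintegral_of_nonneg_ae (ae_of_all _ fun x => by positivity)
    Measurable.of_discrete.aestronglyMeasurable]
  refine ENNReal.toReal_le_of_le_ofReal (by positivity) ?_
  simpa using h.lintegral_le x

theorem one_sub_pos (h : IsContracting κ m) : 0 < 1 - m := by linarith [h.lt_one]

/-! #### First moment of invariant probability measures -/

/-- The mean of `π` could be infinite a priori, so the drift inequality is iterated under a cutoff
`M`, which commutes with integration in the direction needed: `∫ min(f, M) ≤ min(∫ f, M)`. -/
theorem lintegral_min_le [IsMarkovKernel κ] (h : IsContracting κ m) {π : Measure ℕ}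
    [IsProbabilityMeasure π] (hπ : Kernel.Invariant κ π) (M n : ℕ) :
    ∫⁻ x, min (x : ℝ≥0∞) M ∂π ≤
      ∫⁻ x : ℕ, min (ENNReal.ofReal (m / (1 - m) + m ^ n * x)) M ∂π := by
  have hm := h.nonneg
  have h1 := h.one_sub_pos
  -- `m / (1 - m) * (1 - m ^ n) + m ^ n * x` is the `n`-th iterate of the drift `x ↦ m * (x + 1)`.
  have key : ∫⁻ x, min (x : ℝ≥0∞) M ∂π ≤
      ∫⁻ x : ℕ, min (ENNReal.ofReal (m / (1 - m) * (1 - m ^ n) + m ^ n * x)) M ∂π := by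
    induction n with
    | zero => simp
    | succ n ih =>
      refine ih.trans ?_
      have hc : 0 ≤ m / (1 - m) * (1 - m ^ n) :=
        mul_nonneg (by positivity) (sub_nonneg.2 (pow_le_one₀ hm h.lt_one.le))
      conv_lhs => rw [← hπ.def]
      rw [Measure.lintegral_bind κ.measurable.aemeasurable Measurable.of_discrete.aemeasurable]
      refine lintegral_mono fun x => le_min ?_ ?_
      · calc ∫⁻ y : ℕ, min (ENNReal.ofReal (m / (1 - m) * (1 - m ^ n) + m ^ n * y)) M ∂(κ x)
            ≤ ∫⁻ y : ℕ, (ENNReal.ofReal (m / (1 - m) * (1 - m ^ n)) +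
                ENNReal.ofReal (m ^ n) * y) ∂(κ x) := by
              refine lintegral_mono fun y => (min_le_left _ _).trans ?_
              rw [ENNReal.ofReal_add hc (by positivity),
                ENNReal.ofReal_mul (p := m ^ n) (by positivity), ENNReal.ofReal_natCast]
          _ ≤ ENNReal.ofReal (m / (1 - m) * (1 - m ^ n)) +
                ENNReal.ofReal (m ^ n) * ENNReal.ofReal (m * (x + 1)) := by
              rw [lintegral_add_left Measurable.of_discrete,
                lintegral_const_mul _ Measurable.of_discrete]
              simp only [lintegral_const, measure_univ, mul_one]
              gcongr
              exact h.lintegral_le x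
          _ = ENNReal.ofReal (m / (1 - m) * (1 - m ^ (n + 1)) + m ^ (n + 1) * x) := by
              rw [← ENNReal.ofReal_mul (by positivity), ← ENNReal.ofReal_add hc (by positivity)]
              congr 1
              field_simp
              ring
      · refine (lintegral_mono fun y => min_le_right _ _).trans ?_
        simp
  refine key.trans (lintegral_mono fun x => ?_)
  gcongr
  refine mul_le_of_le_one_right (by positivity) ?_
  linarith [pow_nonneg hm n]

/-- First `n → ∞` at fixed cutoff, by dominated convergence; then the cutoff is removed by monotone
convergence. -/
theorem lintegral_invariant_le [IsMarkovKernel κ] (h : IsContracting κ m) {π : Measure ℕ}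
    [IsProbabilityMeasure π] (hπ : Kernel.Invariant κ π) :
    ∫⁻ x, (x : ℝ≥0∞) ∂π ≤ ENNReal.ofReal (m / (1 - m)) := by
  have hM : ∀ M : ℕ, ∫⁻ x, min (x : ℝ≥0∞) M ∂π ≤ ENNReal.ofReal (m / (1 - m)) := by
    intro M
    have hlim : Tendsto (fun n : ℕ =>
        ∫⁻ x : ℕ, min (ENNReal.ofReal (m / (1 - m) + m ^ n * x)) M ∂π) atTop
        (𝓝 (∫⁻ _ : ℕ, min (ENNReal.ofReal (m / (1 - m))) M ∂π)) := by
      refine tendsto_lintegral_of_dominated_convergence (fun _ => (M : ℝ≥0∞))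
        (fun n => Measurable.of_discrete) (fun n => ae_of_all _ fun x => min_le_right _ _)
        (by simp) (ae_of_all _ fun x => ?_)
      refine Tendsto.min ?_ tendsto_const_nhds
      refine (ENNReal.continuous_ofReal.tendsto _).comp ?_
      have := ((tendsto_pow_atTop_nhds_zero_of_lt_one h.nonneg h.lt_one).mul_const
        (x : ℝ)).const_add (m / (1 - m))
      simpa using this
    refine (ge_of_tendsto' hlim fun n => h.lintegral_min_le hπ M n).trans ?_
    simp
  have hsup : ∀ x : ℕ, (x : ℝ≥0∞) = ⨆ M : ℕ, min (x : ℝ≥0∞) M := fun x =>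
    le_antisymm (le_iSup_of_le x (by simp)) (iSup_le fun M => min_le_left _ _)
  calc ∫⁻ x, (x : ℝ≥0∞) ∂π = ∫⁻ x : ℕ, ⨆ M : ℕ, min (x : ℝ≥0∞) M ∂π := by
        simp_rw [← hsup]
    _ = ⨆ M : ℕ, ∫⁻ x : ℕ, min (x : ℝ≥0∞) M ∂π := by
        refine lintegral_iSup (fun M => Measurable.of_discrete) fun M N hMN x => ?_
        simp only
        gcongr
    _ ≤ _ := iSup_le hM

theorem integrable_natCast_invariant [IsMarkovKernel κ] (h : IsContracting κ m) {π : Measure ℕ}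
    [IsProbabilityMeasure π] (hπ : Kernel.Invariant κ π) :
    Integrable (fun x : ℕ => (x : ℝ)) π :=
  integrable_natCast_of_lintegral ((h.lintegral_invariant_le hπ).trans_lt ENNReal.ofReal_lt_top).ne

/-! #### Uniqueness of the invariant probability measure -/

/-- Invariance allows `f` to be replaced by its one-step mean, which divides the Lipschitz constant
by `1 / m`; after `n` rounds both integrals are compared with the value at `0`. -/
theorem abs_integral_sub_integral_le [IsMarkovKernel κ] (h : IsContracting κ m) {π π' : Measure ℕ}
    [IsProbabilityMeasure π] [IsProbabilityMeasure π'] (hπ : Kernel.Invariant κ π)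
    (hπ' : Kernel.Invariant κ π') (n : ℕ) (f : ℕ → ℝ) (L : ℝ)
    (hf : ∀ x, |f (x + 1) - f x| ≤ L) :
    |∫ x, f x ∂π - ∫ x, f x ∂π'| ≤ m ^ n * L * (∫ x : ℕ, (x : ℝ) ∂π + ∫ x : ℕ, (x : ℝ) ∂π') := by
  induction n generalizing f L with
  | zero =>
    have key : ∀ μ : Measure ℕ, IsProbabilityMeasure μ → Integrable (fun x : ℕ => (x : ℝ)) μ →
        |∫ x, f x ∂μ - f 0| ≤ L * ∫ x : ℕ, (x : ℝ) ∂μ := by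
      intro μ _ hμ
      have e : ∫ x, f x ∂μ - f 0 = ∫ x, (f x - f 0) ∂μ := by
        rw [integral_sub (integrable_of_increments hf hμ) (integrable_const _)]
        simp
      rw [e, ← integral_const_mul, ← Real.norm_eq_abs]
      refine norm_integral_le_of_norm_le (hμ.const_mul L) (ae_of_all _ fun x => ?_)
      simpa using abs_sub_le_of_increments hf x 0
    have k1 := key π inferInstance (h.integrable_natCast_invariant hπ)
    have k2 := key π' inferInstance (h.integrable_natCast_invariant hπ')
    have k3 := abs_sub (∫ x, f x ∂π - f 0) (∫ x, f x ∂π' - f 0)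
    rw [sub_sub_sub_cancel_right] at k3
    rw [pow_zero, one_mul, mul_add]
    linarith
  | succ n ih =>
    have key : ∀ μ : Measure ℕ, IsProbabilityMeasure μ → Kernel.Invariant κ μ →
        ∫ x, f x ∂μ = ∫ x, ∫ y, f y ∂(κ x) ∂μ := by
      intro μ _ hμ
      conv_lhs => rw [← hμ.def]
      refine integral_bind ?_
      rw [hμ.def]
      exact integrable_of_increments hf (h.integrable_natCast_invariant hμ)
    rw [key π inferInstance hπ, key π' inferInstance hπ']
    refine (ih _ _ (h.increments f L hf)).trans (le_of_eq ?_)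
    ring

theorem invariant_unique [IsMarkovKernel κ] (h : IsContracting κ m) {π π' : Measure ℕ}
    [IsProbabilityMeasure π] [IsProbabilityMeasure π'] (hπ : Kernel.Invariant κ π)
    (hπ' : Kernel.Invariant κ π') : π = π' := by
  refine Measure.ext_of_singleton fun y => ?_
  have hf : ∀ x : ℕ, |Set.indicator {y} (1 : ℕ → ℝ) x| ≤ 1 := by
    intro x
    by_cases hx : x = y <;> simp [hx]
  have hlim : Tendsto (fun n : ℕ => m ^ n * (2 * 1) *
      (∫ x : ℕ, (x : ℝ) ∂π + ∫ x : ℕ, (x : ℝ) ∂π')) atTop (𝓝 0) := by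
    have := ((tendsto_pow_atTop_nhds_zero_of_lt_one h.nonneg h.lt_one).mul_const (2 * 1)).mul_const
      (∫ x : ℕ, (x : ℝ) ∂π + ∫ x : ℕ, (x : ℝ) ∂π')
    simpa using this
  have h0 := ge_of_tendsto' hlim fun n => h.abs_integral_sub_integral_le hπ hπ' n _ _
    (increments_of_abs_le hf)
  have h1 := sub_eq_zero.1 (abs_nonpos_iff.1 h0)
  rw [integral_indicator_one (measurableSet_singleton y),
    integral_indicator_one (measurableSet_singleton y)] at h1
  exact (measureReal_eq_measureReal_iff).1 h1

end IsContracting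

/-! #### Existence of the invariant probability measure -/

/-- Law at time `n` of the Markov chain on `ℕ` with kernel `κ` started at `0`. -/
noncomputable def lawAt (κ : Kernel ℕ ℕ) : ℕ → Measure ℕ
  | 0 => Measure.dirac 0
  | n + 1 => (lawAt κ n).bind κ

instance (κ : Kernel ℕ ℕ) [IsMarkovKernel κ] (n : ℕ) : IsProbabilityMeasure (lawAt κ n) := by
  induction n with
  | zero => unfold lawAt; infer_instance
  | succ n ih => unfold lawAt; infer_instance

theorem measure_eq_tsum_singleton (μ : Measure ℕ) (s : Set ℕ) :
    μ s = ∑' y, s.indicator (fun y => μ {y}) y :=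
  (Measure.tsum_indicator_apply_singleton μ s .of_discrete).symm

namespace IsContracting

variable {κ : Kernel ℕ ℕ} {m : ℝ}

/-- The bound is the fixed point of `t ↦ m * t + m`, and the chain starts below it. -/
theorem lintegral_lawAt_le [IsMarkovKernel κ] (h : IsContracting κ m) (n : ℕ) :
    ∫⁻ x, (x : ℝ≥0∞) ∂(lawAt κ n) ≤ ENNReal.ofReal (m / (1 - m)) := by
  have hm := h.nonneg
  have h1 := h.one_sub_pos
  induction n with
  | zero => simp [lawAt]
  | succ n ih =>
    rw [lawAt, Measure.lintegral_bind κ.measurable.aemeasurable Measurable.of_discrete.aemeasurable]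
    calc ∫⁻ x, ∫⁻ y, (y : ℝ≥0∞) ∂(κ x) ∂(lawAt κ n)
        ≤ ∫⁻ x : ℕ, (ENNReal.ofReal m * x + ENNReal.ofReal m) ∂(lawAt κ n) := by
          refine lintegral_mono fun x => (h.lintegral_le x).trans (le_of_eq ?_)
          rw [mul_add, mul_one, ENNReal.ofReal_add (by positivity) hm, ENNReal.ofReal_mul hm,
            ENNReal.ofReal_natCast]
      _ ≤ ENNReal.ofReal m * ENNReal.ofReal (m / (1 - m)) + ENNReal.ofReal m := by
          rw [lintegral_add_left Measurable.of_discrete,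
            lintegral_const_mul _ Measurable.of_discrete]
          simp only [lintegral_const, measure_univ, mul_one]
          gcongr
      _ = ENNReal.ofReal (m / (1 - m)) := by
          rw [← ENNReal.ofReal_mul hm, ← ENNReal.ofReal_add (by positivity) hm]
          congr 1
          field_simp
          ring

/-- The two laws are those of chains run for `n` steps from `κ 0` and from `0`, so their initial
distance, at most `m`, is contracted `n` times. The bound `B` only provides integrability. -/
theorem abs_integral_lawAt_succ_sub_le [IsMarkovKernel κ] (h : IsContracting κ m) (n : ℕ)
    (f : ℕ → ℝ) (B L : ℝ) (hB : ∀ x, |f x| ≤ B) (hf : ∀ x, |f (x + 1) - f x| ≤ L) :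
    |∫ x, f x ∂(lawAt κ (n + 1)) - ∫ x, f x ∂(lawAt κ n)| ≤ m ^ n * (L * m) := by
  induction n generalizing f L with
  | zero =>
    have hL : 0 ≤ L := (abs_nonneg _).trans (hf 0)
    have e1 : lawAt κ (0 + 1) = κ 0 := by
      simp only [lawAt]
      exact Measure.dirac_bind κ.measurable 0
    have e2 : ∫ x, f x ∂(lawAt κ 0) = f 0 := by simp [lawAt]
    have e : ∫ x, f x ∂(κ 0) - f 0 = ∫ x, (f x - f 0) ∂(κ 0) := by
      rw [integral_sub (integrable_of_abs_le hB _) (integrable_const _)]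
      simp
    rw [e1, e2, e, pow_zero, one_mul]
    calc |∫ x, (f x - f 0) ∂(κ 0)| ≤ ∫ x : ℕ, L * (x : ℝ) ∂(κ 0) := by
          rw [← Real.norm_eq_abs]
          refine norm_integral_le_of_norm_le ((h.integrable_natCast 0).const_mul L)
            (ae_of_all _ fun x => ?_)
          simpa using abs_sub_le_of_increments hf x 0
      _ ≤ L * m := by
          rw [integral_const_mul]
          gcongr
          simpa using h.integral_le 0
  | succ n ih =>
    rw [lawAt, integral_bind (integrable_of_abs_le hB _)]
    conv_lhs => enter [1, 2]; rw [lawAt, integral_bind (integrable_of_abs_le hB _)]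
    refine (ih _ _ (fun x => abs_integral_le hB _) (h.increments f L hf)).trans (le_of_eq ?_)
    ring

theorem exists_tendsto_lawAt [IsMarkovKernel κ] (h : IsContracting κ m) (y : ℕ) :
    ∃ l : ℝ≥0∞, Tendsto (fun n => lawAt κ n {y}) atTop (𝓝 l) := by
  have hB : ∀ x : ℕ, |Set.indicator {y} (1 : ℕ → ℝ) x| ≤ 1 := by
    intro x
    by_cases hx : x = y <;> simp [hx]
  have hc : CauchySeq fun n => (lawAt κ n).real {y} := by
    refine cauchySeq_of_le_geometric m (2 * 1 * m) h.lt_one fun n => ?_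
    have := h.abs_integral_lawAt_succ_sub_le n _ 1 (2 * 1) hB (increments_of_abs_le hB)
    rw [integral_indicator_one (measurableSet_singleton y),
      integral_indicator_one (measurableSet_singleton y)] at this
    rw [dist_comm, Real.dist_eq]
    linarith
  obtain ⟨l, hl⟩ := cauchySeq_tendsto_of_complete hc
  refine ⟨ENNReal.ofReal l, ?_⟩
  have := (ENNReal.continuous_ofReal.tendsto l).comp hl
  refine this.congr fun n => ?_
  simp

/-- The laws started at `0` converge pointwise. Fatou's lemma bounds the mass of the limit by `1`
and makes it sub-invariant; the uniform first moment prevents loss of mass; and a sub-invariant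
probability measure of a Markov kernel is invariant. -/
theorem exists_invariant [IsMarkovKernel κ] (h : IsContracting κ m) :
    ∃ π : Measure ℕ, IsProbabilityMeasure π ∧ Kernel.Invariant κ π := by
  choose l hl using h.exists_tendsto_lawAt
  let π : Measure ℕ := Measure.sum fun y => l y • Measure.dirac y
  have hπs : ∀ y, π {y} = l y := by
    intro y
    simp only [π]
    rw [Measure.sum_apply _ (measurableSet_singleton y), tsum_eq_single y]
    · simp
    · intro z hz
      simp [hz]
  have fatou : ∀ g : ℕ → ℝ≥0∞, (∀ y, g y ≠ ∞) →
      ∑' y, g y * l y ≤ liminf (fun n => ∫⁻ y, g y ∂(lawAt κ n)) atTop := by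
    intro g hg
    have e : ∀ y, g y * l y = liminf (fun n => g y * lawAt κ n {y}) atTop := fun y =>
      (ENNReal.Tendsto.const_mul (hl y) (Or.inr (hg y))).liminf_eq.symm
    simp_rw [lintegral_countable', e]
    simp_rw [← lintegral_count]
    exact lintegral_liminf_le fun n => Measurable.of_discrete
  have huniv : ∀ μ : Measure ℕ, μ Set.univ = ∑' y, μ {y} := fun μ => by
    simpa using measure_eq_tsum_singleton μ Set.univ
  have hle : π Set.univ ≤ 1 := by
    rw [huniv]
    simp_rw [hπs]
    simpa using fatou 1 (by simp)
  have hge : 1 ≤ π Set.univ := by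
    -- Tightness: by Markov's inequality the mass beyond `K` is at most the mean divided by `K + 1`,
    -- uniformly in time.
    have hK : ∀ K : ℕ, 1 ≤ π Set.univ + ENNReal.ofReal (m / (1 - m)) / ((K + 1 : ℕ) : ℝ≥0∞) := by
      intro K
      have hn : ∀ n, 1 ≤ ∑ y ∈ Finset.range (K + 1), lawAt κ n {y} +
          ENNReal.ofReal (m / (1 - m)) / ((K + 1 : ℕ) : ℝ≥0∞) := by
        intro n
        have hu : (Set.univ : Set ℕ) ⊆
            ↑(Finset.range (K + 1)) ∪ {y : ℕ | ((K + 1 : ℕ) : ℝ≥0∞) ≤ y} := by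
          intro y _
          rcases lt_or_ge y (K + 1) with hy | hy
          · left; simpa using hy
          · right; simpa using (Nat.cast_le (α := ℝ≥0∞)).2 hy
        calc (1 : ℝ≥0∞) = lawAt κ n Set.univ := measure_univ.symm
          _ ≤ _ := measure_mono hu
          _ ≤ _ := measure_union_le _ _
          _ ≤ _ := by
            refine add_le_add (le_of_eq ?_) ?_
            · simp
            · refine (meas_ge_le_lintegral_div Measurable.of_discrete.aemeasurable (by simp)
                (by simp)).trans ?_
              gcongr
              exact h.lintegral_lawAt_le n
      have hlim := (tendsto_finsetSum (Finset.range (K + 1)) fun y _ => hl y).add_const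
        (ENNReal.ofReal (m / (1 - m)) / ((K + 1 : ℕ) : ℝ≥0∞))
      refine (ge_of_tendsto' hlim hn).trans ?_
      gcongr
      rw [huniv]
      simp_rw [hπs]
      exact ENNReal.sum_le_tsum _
    have hlim : Tendsto (fun K : ℕ => π Set.univ +
        ENNReal.ofReal (m / (1 - m)) / ((K + 1 : ℕ) : ℝ≥0∞)) atTop (𝓝 (π Set.univ + 0)) := by
      refine Tendsto.const_add _ ?_
      have h0 : Tendsto (fun K : ℕ => ENNReal.ofReal (m / (1 - m)) / (K : ℝ≥0∞)) atTop (𝓝 0) := by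
        simpa using ENNReal.Tendsto.const_div ENNReal.tendsto_nat_nhds_top
          (Or.inr (ENNReal.ofReal_ne_top (r := m / (1 - m))))
      exact h0.comp (tendsto_add_atTop_nat 1)
    simpa using ge_of_tendsto' hlim hK
  have hprob : IsProbabilityMeasure π := ⟨le_antisymm hle hge⟩
  refine ⟨π, hprob, ?_⟩
  have hsing : ∀ y, (π.bind κ) {y} ≤ π {y} := by
    intro y
    rw [Measure.bind_apply (measurableSet_singleton y) κ.measurable.aemeasurable, hπs,
      lintegral_countable']
    simp_rw [hπs]
    refine (fatou (fun x => κ x {y}) (by simp)).trans (le_of_eq ?_)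
    have e : ∀ n, ∫⁻ x, κ x {y} ∂(lawAt κ n) = lawAt κ (n + 1) {y} := fun n => by
      rw [lawAt, Measure.bind_apply (measurableSet_singleton y) κ.measurable.aemeasurable]
    simp_rw [e]
    exact ((hl y).comp (tendsto_add_atTop_nat 1)).liminf_eq
  refine Measure.eq_of_le_of_measure_univ_eq (Measure.le_iff.2 fun s _ => ?_) (by simp)
  rw [measure_eq_tsum_singleton _ s, measure_eq_tsum_singleton _ s]
  exact ENNReal.tsum_le_tsum fun y => Set.indicator_le_indicator (hsing y)

end IsContracting

/-! ### Additive functionals of a Markov chain on `ℕ` -/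

/-- Sum over all trajectories `x, y 0, …, y (n - 1)` of the Markov chain with kernel `κ` started at
`x`, of the function `F` weighted by the probability of the trajectory. -/
noncomputable def chainExp (κ : Kernel ℕ ℕ) (n x : ℕ) (F : (Fin n → ℕ) → ℝ≥0∞) : ℝ≥0∞ :=
  ∑' y : Fin n → ℕ, F y * ∏ i : Fin n, κ ((Fin.cons x y : Fin (n + 1) → ℕ) i.castSucc) {y i}

/-- The additive functional `∑ g(z_i, z_{i+1})` along the trajectory `x, y 0, …, y (n - 1)`. -/
def chainSum (g : ℕ → ℕ → ℝ) (n x : ℕ) (y : Fin n → ℕ) : ℝ :=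
  ∑ i : Fin n, g ((Fin.cons x y : Fin (n + 1) → ℕ) i.castSucc) (y i)

theorem chainExp_zero (κ : Kernel ℕ ℕ) (x : ℕ) (F : (Fin 0 → ℕ) → ℝ≥0∞) :
    chainExp κ 0 x F = F Fin.elim0 := by
  unfold chainExp
  rw [tsum_eq_single Fin.elim0 (fun y hy => absurd (Subsingleton.elim _ _) hy)]
  simp

theorem chainExp_succ (κ : Kernel ℕ ℕ) (n x : ℕ) (F : (Fin (n + 1) → ℕ) → ℝ≥0∞) :
    chainExp κ (n + 1) x F =
      ∫⁻ a, chainExp κ n a (fun y => F (Fin.cons a y)) ∂(κ x) := by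
  rw [lintegral_countable']
  unfold chainExp
  rw [← (Fin.consEquiv (fun _ : Fin (n + 1) => ℕ)).tsum_eq, ENNReal.tsum_prod']
  refine tsum_congr fun a => ?_
  rw [← ENNReal.tsum_mul_right]
  refine tsum_congr fun y => ?_
  rw [Fin.prod_univ_succ]
  simp only [Fin.consEquiv_apply, Fin.castSucc_zero, Fin.cons_zero, Fin.cons_succ, mul_assoc]
  congr 1
  rw [mul_comm]
  congr 1

theorem chainExp_mono (κ : Kernel ℕ ℕ) (n x : ℕ) {F G : (Fin n → ℕ) → ℝ≥0∞} (h : ∀ y, F y ≤ G y) :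
    chainExp κ n x F ≤ chainExp κ n x G :=
  ENNReal.tsum_le_tsum fun y => by gcongr; exact h y

theorem chainExp_add (κ : Kernel ℕ ℕ) (n x : ℕ) (F G : (Fin n → ℕ) → ℝ≥0∞) :
    chainExp κ n x (fun y => F y + G y) = chainExp κ n x F + chainExp κ n x G := by
  unfold chainExp
  rw [← ENNReal.tsum_add]
  simp_rw [add_mul]

theorem chainExp_const_mul (κ : Kernel ℕ ℕ) (n x : ℕ) (c : ℝ≥0∞) (F : (Fin n → ℕ) → ℝ≥0∞) :
    chainExp κ n x (fun y => c * F y) = c * chainExp κ n x F := by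
  unfold chainExp
  rw [← ENNReal.tsum_mul_left]
  simp_rw [mul_assoc]

theorem chainSum_cons (g : ℕ → ℕ → ℝ) (n x a : ℕ) (y : Fin n → ℕ) :
    chainSum g (n + 1) x (Fin.cons a y) = g x a + chainSum g n a y := by
  unfold chainSum
  rw [Fin.sum_univ_succ]
  simp only [Fin.castSucc_zero, Fin.cons_zero, Fin.cons_succ]
  congr 1

/-- Mean of `chainSum g n x`. -/
noncomputable def sumMean (κ : Kernel ℕ ℕ) (g : ℕ → ℕ → ℝ) : ℕ → ℕ → ℝ
  | 0, _ => 0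
  | n + 1, x => ∫ y, (g x y + sumMean κ g n y) ∂(κ x)

/-- Second moment of `chainSum g n x`. -/
noncomputable def sumSq (κ : Kernel ℕ ℕ) (g : ℕ → ℕ → ℝ) : ℕ → ℕ → ℝ
  | 0, _ => 0
  | n + 1, x => ∫ y, (g x y ^ 2 + 2 * g x y * sumMean κ g n y + sumSq κ g n y) ∂(κ x)

/-! ### Exact second moments of bounded additive functionals -/

section Bounded

variable {κ : Kernel ℕ ℕ} [IsMarkovKernel κ] {g : ℕ → ℕ → ℝ} {B : ℝ}

theorem abs_sumMean_le (hg : ∀ x y, |g x y| ≤ B) (n x : ℕ) : |sumMean κ g n x| ≤ n * B := by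
  induction n generalizing x with
  | zero => simp [sumMean]
  | succ n ih =>
    refine abs_integral_le (fun y => ?_) _
    refine (abs_add_le _ _).trans ?_
    push_cast
    linarith [hg x y, ih y]

theorem exists_abs_sumSq_le (hg : ∀ x y, |g x y| ≤ B) (n : ℕ) :
    ∃ C, ∀ x, |sumSq κ g n x| ≤ C := by
  have hB : 0 ≤ B := (abs_nonneg _).trans (hg 0 0)
  induction n with
  | zero => exact ⟨0, fun x => by simp [sumSq]⟩
  | succ n ih =>
    obtain ⟨C, hC⟩ := ih
    refine ⟨B ^ 2 + 2 * B * (n * B) + C, fun x => abs_integral_le (fun y => ?_) _⟩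
    refine (abs_add_le _ _).trans (add_le_add ((abs_add_le _ _).trans (add_le_add ?_ ?_)) (hC y))
    · rw [abs_pow]
      exact pow_le_pow_left₀ (abs_nonneg _) (hg x y) 2
    · rw [abs_mul, abs_mul, abs_two]
      have := abs_sumMean_le (κ := κ) hg n y
      have := hg x y
      gcongr

theorem integrable_sumSq_integrand (hg : ∀ x y, |g x y| ≤ B) (n x : ℕ) :
    Integrable (fun y => g x y ^ 2 + 2 * g x y * sumMean κ g n y + sumSq κ g n y) (κ x) := by
  obtain ⟨C, hC⟩ := exists_abs_sumSq_le (κ := κ) hg n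
  refine Integrable.add (Integrable.add ?_ ?_) (integrable_of_abs_le hC _)
  · refine integrable_of_abs_le (B := B ^ 2) (fun y => ?_) _
    rw [abs_pow]
    exact pow_le_pow_left₀ (abs_nonneg _) (hg x y) 2
  · refine integrable_of_abs_le (B := 2 * B * (n * B)) (fun y => ?_) _
    rw [abs_mul, abs_mul, abs_two]
    have := abs_sumMean_le (κ := κ) hg n y
    have := hg x y
    have hB : 0 ≤ B := (abs_nonneg _).trans this
    gcongr

/-- The shift `s` stands for the part of the sum already collected, so that the induction on the
first step closes. Nonnegativity is carried along to pass between real and extended integrals. -/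
theorem chainExp_sq_eq (hg : ∀ x y, |g x y| ≤ B) (n x : ℕ) (s : ℝ) :
    0 ≤ s ^ 2 + 2 * s * sumMean κ g n x + sumSq κ g n x ∧
    chainExp κ n x (fun y => ENNReal.ofReal ((s + chainSum g n x y) ^ 2)) =
      ENNReal.ofReal (s ^ 2 + 2 * s * sumMean κ g n x + sumSq κ g n x) := by
  induction n generalizing x s with
  | zero =>
    refine ⟨by simp [sumMean, sumSq]; positivity, ?_⟩
    rw [chainExp_zero]
    simp [sumMean, sumSq, chainSum]
  | succ n ih =>
    have i1 : Integrable (fun y => g x y + sumMean κ g n y) (κ x) :=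
      (integrable_of_abs_le (hg x) _).add (integrable_of_abs_le (abs_sumMean_le hg n) _)
    have i2 := integrable_sumSq_integrand (κ := κ) hg n x
    have e : s ^ 2 + 2 * s * sumMean κ g (n + 1) x + sumSq κ g (n + 1) x =
        ∫ y, ((s + g x y) ^ 2 + 2 * (s + g x y) * sumMean κ g n y + sumSq κ g n y) ∂(κ x) := by
      have e1 : (fun y => (s + g x y) ^ 2 + 2 * (s + g x y) * sumMean κ g n y + sumSq κ g n y) =
          fun y => (s ^ 2 + 2 * s * (g x y + sumMean κ g n y)) +
            (g x y ^ 2 + 2 * g x y * sumMean κ g n y + sumSq κ g n y) := by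
        funext y
        ring
      have i4 : Integrable (fun y => s ^ 2 + 2 * s * (g x y + sumMean κ g n y)) (κ x) :=
        (integrable_const _).add (i1.const_mul _)
      rw [e1, integral_add i4 i2, integral_add (integrable_const _) (i1.const_mul _), integral_const_mul]
      simp [sumMean, sumSq]
    have i3 : Integrable (fun y => (s + g x y) ^ 2 + 2 * (s + g x y) * sumMean κ g n y +
        sumSq κ g n y) (κ x) := by
      refine (((integrable_const (s ^ 2)).add (i1.const_mul (2 * s))).add i2).congr
        (ae_of_all _ fun y => ?_)
      simp only [Pi.add_apply]
      ring
    refine ⟨?_, ?_⟩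
    · rw [e]
      exact integral_nonneg fun y => (ih y _).1
    · rw [e, ofReal_integral_eq_lintegral_ofReal i3 (ae_of_all _ fun y => (ih y _).1),
        chainExp_succ]
      refine lintegral_congr fun a => ?_
      rw [← (ih a _).2]
      simp_rw [chainSum_cons, add_assoc]

end Bounded

/-! ### Means and variances of additive functionals under contraction -/

namespace IsContracting

variable {κ : Kernel ℕ ℕ} {m : ℝ}

theorem sumMean_succ [IsMarkovKernel κ] (h : IsContracting κ m) {g : ℕ → ℕ → ℝ} {n : ℕ} {D : ℝ}
    (hg : ∀ x, Integrable (g x) (κ x))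
    (hn : ∀ x, |sumMean κ g n (x + 1) - sumMean κ g n x| ≤ D) (x : ℕ) :
    sumMean κ g (n + 1) x = ∫ y, g x y ∂(κ x) + ∫ y, sumMean κ g n y ∂(κ x) :=
  integral_add (hg x) (integrable_of_increments hn (h.integrable_natCast x))

/-- `L / (1 - m)` is the fixed point of `t ↦ L + m * t`: one more step adds `L` and contracts the
earlier constant. -/
theorem sumMean_increments [IsMarkovKernel κ] (h : IsContracting κ m) {g : ℕ → ℕ → ℝ} {L : ℝ}
    (hg : ∀ x, Integrable (g x) (κ x))
    (hL : ∀ x, |∫ y, g (x + 1) y ∂(κ (x + 1)) - ∫ y, g x y ∂(κ x)| ≤ L) (n x : ℕ) :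
    |sumMean κ g n (x + 1) - sumMean κ g n x| ≤ L / (1 - m) := by
  have h1 := h.one_sub_pos
  have hL0 : 0 ≤ L := (abs_nonneg _).trans (hL 0)
  induction n generalizing x with
  | zero => simp only [sumMean, sub_self, abs_zero]; positivity
  | succ n ih =>
    rw [h.sumMean_succ hg ih, h.sumMean_succ hg ih, add_sub_add_comm]
    refine (abs_add_le _ _).trans ((add_le_add (hL x) (h.increments _ _ ih x)).trans (le_of_eq ?_))
    field_simp
    ring

theorem integral_invariant [IsMarkovKernel κ] (h : IsContracting κ m) {π : Measure ℕ}
    [IsProbabilityMeasure π] (hπ : Kernel.Invariant κ π) {f : ℕ → ℝ} {L : ℝ}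
    (hf : ∀ x, |f (x + 1) - f x| ≤ L) : ∫ x, ∫ y, f y ∂(κ x) ∂π = ∫ x, f x ∂π := by
  conv_rhs => rw [← hπ.def]
  refine (integral_bind ?_).symm
  rw [hπ.def]
  exact integrable_of_increments hf (h.integrable_natCast_invariant hπ)

theorem integral_sumMean [IsMarkovKernel κ] (h : IsContracting κ m) {π : Measure ℕ}
    [IsProbabilityMeasure π] (hπ : Kernel.Invariant κ π) {g : ℕ → ℕ → ℝ} {L : ℝ}
    (hg : ∀ x, Integrable (g x) (κ x))
    (hL : ∀ x, |∫ y, g (x + 1) y ∂(κ (x + 1)) - ∫ y, g x y ∂(κ x)| ≤ L) (n : ℕ) :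
    ∫ x, sumMean κ g n x ∂π = n * ∫ x, ∫ y, g x y ∂(κ x) ∂π := by
  induction n with
  | zero => simp [sumMean]
  | succ n ih =>
    have hn := h.sumMean_increments hg hL n
    have hint := h.integrable_natCast_invariant hπ
    simp_rw [h.sumMean_succ hg hn]
    rw [integral_add (integrable_of_increments hL hint)
      (integrable_of_increments (h.increments _ _ hn) hint), h.integral_invariant hπ hn, ih]
    push_cast
    ring

/-- The subtracted term is the `π`-average of `sumMean κ g n`, whose Lipschitz constant does not
depend on `n`. Hence the starting point matters only by a bounded amount. -/
theorem abs_sumMean_sub_le [IsMarkovKernel κ] (h : IsContracting κ m) {π : Measure ℕ}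
    [IsProbabilityMeasure π] (hπ : Kernel.Invariant κ π) {g : ℕ → ℕ → ℝ} {L : ℝ}
    (hg : ∀ x, Integrable (g x) (κ x))
    (hL : ∀ x, |∫ y, g (x + 1) y ∂(κ (x + 1)) - ∫ y, g x y ∂(κ x)| ≤ L) (n x : ℕ) :
    |sumMean κ g n x - n * ∫ x, ∫ y, g x y ∂(κ x) ∂π| ≤
      L / (1 - m) * (x + ∫ x : ℕ, (x : ℝ) ∂π) := by
  have hn := h.sumMean_increments hg hL n
  have hint := h.integrable_natCast_invariant hπ
  rw [← h.integral_sumMean hπ hg hL]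
  have e : sumMean κ g n x - ∫ x', sumMean κ g n x' ∂π =
      ∫ x', (sumMean κ g n x - sumMean κ g n x') ∂π := by
    rw [integral_sub (integrable_const _) (integrable_of_increments hn hint)]
    simp
  have e2 : L / (1 - m) * (x + ∫ x : ℕ, (x : ℝ) ∂π) =
      ∫ x' : ℕ, L / (1 - m) * ((x : ℝ) + x') ∂π := by
    rw [integral_const_mul, integral_add (integrable_const _) hint]
    simp
  rw [e, e2, ← Real.norm_eq_abs]
  refine norm_integral_le_of_norm_le (((integrable_const _).add hint).const_mul _)
    (ae_of_all _ fun x' => abs_sub_le_of_increments hn x x')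

/-- The second moment of a bounded centred additive functional grows at most linearly. -/
theorem exists_chainExp_sq_le [IsMarkovKernel κ] (h : IsContracting κ m) {π : Measure ℕ}
    [IsProbabilityMeasure π] (hπ : Kernel.Invariant κ π) {g : ℕ → ℕ → ℝ} {B : ℝ}
    (hg : ∀ x y, |g x y| ≤ B) (hc : ∫ x, ∫ y, g x y ∂(κ x) ∂π = 0) :
    ∃ α : ℝ, 0 ≤ α ∧ ∀ n : ℕ, chainExp κ n 0 (fun y => ENNReal.ofReal (chainSum g n 0 y ^ 2)) ≤
      ENNReal.ofReal (α * n) := by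
  have h1 := h.one_sub_pos
  have hm := h.nonneg
  have hB : 0 ≤ B := (abs_nonneg _).trans (hg 0 0)
  set μ₁ := ∫ x : ℕ, (x : ℝ) ∂π with hμ₁
  have hμ₁0 : 0 ≤ μ₁ := integral_nonneg fun x => by positivity
  set D := 2 * B / (1 - m) with hD
  have hD0 : 0 ≤ D := by positivity
  -- Centring removes the term proportional to `n`, so the conditional means do not grow with `n`.
  -- This makes the cross terms, and then the second moment, linear and not quadratic in `n`.
  have hM : ∀ n x, |sumMean κ g n x| ≤ D * (x + μ₁) := by
    intro n x
    have := h.abs_sumMean_sub_le hπ (fun x => integrable_of_abs_le (hg x) _)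
      (increments_of_abs_le (fun x => abs_integral_le (hg x) (κ x))) n x
    rwa [hc, mul_zero, sub_zero] at this
  -- One step of the recursion turns a bound with slope `β` in `x` into one with slope `b + β * m`;
  -- `β` is chosen so that these agree, and `β * m + a` is then the increment per step.
  set b := 2 * B * D * m with hb
  set a := B ^ 2 + 2 * B * D * (m + μ₁) with ha
  set β := b / (1 - m) with hβ
  have hβ0 : 0 ≤ β := by positivity
  have hV : ∀ n x : ℕ, sumSq κ g n x ≤ (β * m + a) * n + β * x := by
    intro n
    induction n with
    | zero => intro x; simp only [sumSq, Nat.cast_zero, mul_zero, zero_add]; positivity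
    | succ n ih =>
      intro x
      have hint := h.integrable_natCast x
      calc sumSq κ g (n + 1) x
          ≤ ∫ y : ℕ, ((B ^ 2 + 2 * B * D * μ₁ + (β * m + a) * n) + (2 * B * D + β) * (y : ℝ))
              ∂(κ x) := by
            refine integral_mono (integrable_sumSq_integrand hg n x)
              ((integrable_const _).add (hint.const_mul _)) fun y => ?_
            have i1 : g x y ^ 2 ≤ B ^ 2 := sq_le_sq' (abs_le.1 (hg x y)).1 (abs_le.1 (hg x y)).2
            have i2 : g x y * sumMean κ g n y ≤ B * (D * (y + μ₁)) :=
              (le_abs_self _).trans ((abs_mul _ _).le.trans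
                (mul_le_mul (hg x y) (hM n y) (abs_nonneg _) hB))
            have i3 := ih y
            simp only
            linarith
        _ = (B ^ 2 + 2 * B * D * μ₁ + (β * m + a) * n) +
              (2 * B * D + β) * ∫ y : ℕ, (y : ℝ) ∂(κ x) := by
            rw [integral_add (integrable_const _) (hint.const_mul _), integral_const_mul]
            simp
        _ ≤ (B ^ 2 + 2 * B * D * μ₁ + (β * m + a) * n) + (2 * B * D + β) * (m * (x + 1)) := by
            gcongr
            exact h.integral_le x
        _ = (β * m + a) * ((n + 1 : ℕ) : ℝ) + β * x := by
            have : b + β * m = β := by rw [hβ]; field_simp; ring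
            push_cast
            rw [ha]
            linear_combination (x : ℝ) * (this - hb)
  refine ⟨β * m + a, by positivity, fun n => ?_⟩
  have e := (chainExp_sq_eq (κ := κ) hg n 0 0).2
  simp only [zero_add, ne_eq, OfNat.ofNat_ne_zero, not_false_eq_true, zero_pow, mul_zero,
    zero_mul] at e
  rw [e]
  refine ENNReal.ofReal_le_ofReal ?_
  simpa using hV n 0

/-- Mean of the additive functional of a nonnegative function with bounded increments. -/
theorem chainExp_sum_eq [IsMarkovKernel κ] (h : IsContracting κ m) {u : ℕ → ℝ} {L : ℝ}
    (hu : ∀ x, |u (x + 1) - u x| ≤ L) (hu0 : ∀ x, 0 ≤ u x) (n x : ℕ) :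
    0 ≤ sumMean κ (fun _ => u) n x ∧ ∀ s : ℝ, 0 ≤ s →
    chainExp κ n x (fun y => ENNReal.ofReal (s + chainSum (fun _ => u) n x y)) =
      ENNReal.ofReal (s + sumMean κ (fun _ => u) n x) := by
  have hg : ∀ x, Integrable u (κ x) := fun x => integrable_of_increments hu (h.integrable_natCast x)
  induction n generalizing x with
  | zero =>
    refine ⟨le_rfl, fun s hs => ?_⟩
    rw [chainExp_zero]
    simp [sumMean, chainSum]
  | succ n ih =>
    have hn := h.sumMean_increments (g := fun _ => u) hg (h.increments u L hu) n
    have i1 : Integrable (fun y => u y + sumMean κ (fun _ => u) n y) (κ x) :=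
      (hg x).add (integrable_of_increments hn (h.integrable_natCast x))
    refine ⟨integral_nonneg fun y => add_nonneg (hu0 y) (ih y).1, fun s hs => ?_⟩
    have e : s + sumMean κ (fun _ => u) (n + 1) x =
        ∫ y, (s + (u y + sumMean κ (fun _ => u) n y)) ∂(κ x) := by
      rw [integral_add (integrable_const _) i1]
      simp [sumMean]
    have i2 : Integrable (fun y => s + (u y + sumMean κ (fun _ => u) n y)) (κ x) :=
      (integrable_const _).add i1
    rw [e, ofReal_integral_eq_lintegral_ofReal i2
      (ae_of_all _ fun y => add_nonneg hs (add_nonneg (hu0 y) (ih y).1)), chainExp_succ]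
    refine lintegral_congr fun a => ?_
    rw [← add_assoc, ← (ih a).2 _ (add_nonneg hs (hu0 a))]
    simp_rw [chainSum_cons, add_assoc]

/-- Since `u` is evaluated at the arrival state, its one-step mean has Lipschitz constant `m * L`;
the second term is the bounded cost of starting at `0` instead of `π`. -/
theorem chainExp_sum_le [IsMarkovKernel κ] (h : IsContracting κ m) {π : Measure ℕ}
    [IsProbabilityMeasure π] (hπ : Kernel.Invariant κ π) {u : ℕ → ℝ} {L : ℝ}
    (hu : ∀ x, |u (x + 1) - u x| ≤ L) (hu0 : ∀ x, 0 ≤ u x) (n : ℕ) :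
    chainExp κ n 0 (fun y => ENNReal.ofReal (chainSum (fun _ => u) n 0 y)) ≤
      ENNReal.ofReal (n * ∫ x, u x ∂π + m * L / (1 - m) * ∫ x : ℕ, (x : ℝ) ∂π) := by
  have e := (h.chainExp_sum_eq hu hu0 n 0).2 0 le_rfl
  simp only [zero_add] at e
  rw [e]
  refine ENNReal.ofReal_le_ofReal ?_
  have := h.abs_sumMean_sub_le hπ (g := fun _ => u)
    (fun x => integrable_of_increments hu (h.integrable_natCast x)) (h.increments u L hu) n 0
  rw [h.integral_invariant hπ hu] at this
  have := (abs_le.1 this).2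
  simp only [Nat.cast_zero, zero_add] at this
  linarith

end IsContracting

/-! ### The branching process is contracting -/

/-- Probability that the `B`-th success of a sequence of independent trials with success
probability `a` is preceded by exactly `r` failures. -/
noncomputable def negBinom (a : ℝ) (B r : ℕ) : ℝ :=
  (B.multichoose r : ℝ) * a ^ B * (1 - a) ^ r

theorem negBinom_nonneg (a : Set.Ioo (0 : ℝ) 1) (B r : ℕ) : 0 ≤ negBinom a B r := by
  have h0 : 0 < (a : ℝ) := a.2.1
  have h2 : (0 : ℝ) < 1 - a := by linarith [a.2.2]
  unfold negBinom
  positivity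

theorem measurable_negBinom (B r : ℕ) :
    Measurable fun a : Set.Ioo (0 : ℝ) 1 => negBinom a B r := by
  unfold negBinom
  fun_prop

theorem negBinom_succ_zero (a : ℝ) (B : ℕ) : negBinom a (B + 1) 0 = a * negBinom a B 0 := by
  simp [negBinom, Nat.multichoose_zero_right, pow_succ']

/-- Condition on the first trial. The same recursion yields the contraction of the kernel and the
supermartingale property of `completionProb`. -/
theorem negBinom_succ_succ (a : ℝ) (B r : ℕ) :
    negBinom a (B + 1) (r + 1) = a * negBinom a B (r + 1) + (1 - a) * negBinom a (B + 1) r := by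
  simp only [negBinom, Nat.multichoose_succ_succ]
  push_cast
  ring

/-- The `x` individuals and the immigrant together produce the failures before `x + 1` successes. -/
theorem transProb_eq_integral_negBinom (ν : Measure (Set.Ioo (0 : ℝ) 1)) (x y : ℕ) :
    transProb ν x y = ∫ a, negBinom a (x + 1) y ∂ν := by
  rw [transProb, moment, ← integral_const_mul]
  congr 1
  funext a
  have : (x + y).choose x = (x + 1).multichoose y := by
    rw [Nat.multichoose_eq, Nat.add_right_comm, Nat.add_sub_cancel]
    exact Nat.choose_symm_add
  rw [this, negBinom, mul_assoc]

theorem hasSum_negBinom (a : Set.Ioo (0 : ℝ) 1) (B : ℕ) : HasSum (negBinom a B) 1 := by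
  have h0 : 0 < (a : ℝ) := a.2.1
  have h2 : (0 : ℝ) < 1 - a := by linarith [a.2.2]
  cases B with
  | zero =>
    have e : negBinom a 0 = fun r => if r = 0 then 1 else 0 := by
      funext r
      cases r <;> simp [negBinom]
    rw [e]
    exact hasSum_ite_eq 0 1
  | succ x =>
    have hs := (hasSum_choose_mul_geometric_of_norm_lt_one (𝕜 := ℝ) x (r := 1 - (a : ℝ))
      (by rw [Real.norm_of_nonneg h2.le]; linarith)).mul_left ((a : ℝ) ^ (x + 1))
    rw [sub_sub_cancel, mul_one_div_cancel (by positivity)] at hs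
    have e : negBinom a (x + 1) =
        fun y => (a : ℝ) ^ (x + 1) * (((y + x).choose x : ℝ) * (1 - (a : ℝ)) ^ y) := by
      funext y
      have : (y + x).choose x = (x + 1).multichoose y := by
        rw [Nat.multichoose_eq, Nat.add_right_comm, Nat.add_sub_cancel, add_comm y]
        exact Nat.choose_symm_add
      rw [this, negBinom]
      ring
    rw [e]
    exact hs

theorem succ_mul_multichoose_succ (B r : ℕ) :
    (r + 1) * B.multichoose (r + 1) = B * (B + 1).multichoose r := by
  rw [Nat.multichoose_eq, Nat.multichoose_eq, mul_comm, ← add_assoc, Nat.add_sub_cancel,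
    Nat.add_right_comm, Nat.add_sub_cancel, Nat.choose_succ_right_eq, Nat.add_sub_cancel, mul_comm]

/-- Size biasing: `(r + 1) * negBinom a B (r + 1) = B * rho a * negBinom a (B + 1) r`, and the
right-hand weights sum to one. -/
theorem hasSum_mul_negBinom (a : Set.Ioo (0 : ℝ) 1) (B : ℕ) :
    HasSum (fun r : ℕ => (r : ℝ) * negBinom a B r) (B * rho a) := by
  have h0 : 0 < (a : ℝ) := a.2.1
  have h := (hasSum_negBinom a (B + 1)).mul_left (B * rho a)
  rw [mul_one] at h
  rw [← hasSum_nat_add_iff' 1]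
  simp only [Finset.range_one, Finset.sum_singleton, Nat.cast_zero, zero_mul, sub_zero]
  have e : (fun r : ℕ => ((r + 1 : ℕ) : ℝ) * negBinom a B (r + 1)) =
      fun r => B * rho a * negBinom a (B + 1) r := by
    funext r
    have e := congrArg (Nat.cast (R := ℝ)) (succ_mul_multichoose_succ B r)
    push_cast at e
    rw [negBinom, negBinom, rho]
    push_cast
    rw [← mul_assoc, ← mul_assoc, e]
    field_simp
    ring
  rw [e]
  exact h

theorem norm_negBinom_mul_le {f : ℕ → ℝ} {L : ℝ} (hf : ∀ x, |f (x + 1) - f x| ≤ L)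
    (a : Set.Ioo (0 : ℝ) 1) (B r : ℕ) :
    ‖negBinom a B r * f r‖ ≤ |f 0| * negBinom a B r + L * (r * negBinom a B r) := by
  rw [norm_mul, Real.norm_of_nonneg (negBinom_nonneg a B r), Real.norm_eq_abs]
  have := mul_le_mul_of_nonneg_left (abs_le_of_increments hf r) (negBinom_nonneg a B r)
  linarith

theorem hasSum_affine_negBinom (a : Set.Ioo (0 : ℝ) 1) (B : ℕ) (c L : ℝ) :
    HasSum (fun r : ℕ => c * negBinom a B r + L * (r * negBinom a B r)) (c + L * (B * rho a)) := by
  simpa using ((hasSum_negBinom a B).mul_left c).add ((hasSum_mul_negBinom a B).mul_left L)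

theorem summable_negBinom_mul {f : ℕ → ℝ} {L : ℝ} (hf : ∀ x, |f (x + 1) - f x| ≤ L)
    (a : Set.Ioo (0 : ℝ) 1) (B : ℕ) : Summable fun r => negBinom a B r * f r :=
  (hasSum_affine_negBinom a B (|f 0|) L).summable.of_norm_bounded
    (norm_negBinom_mul_le hf a B)

theorem rho_pos (a : Set.Ioo (0 : ℝ) 1) : 0 < rho a := by
  have h0 : 0 < (a : ℝ) := a.2.1
  have h2 : (0 : ℝ) < 1 - a := by linarith [a.2.2]
  unfold rho
  positivity

theorem measurable_rho : Measurable rho := by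
  unfold rho
  fun_prop

/-- Write `E_B f` for the mean of `f`. Conditioning on the first trial gives `E_{B+1} f = a E_B f +
(1 - a) E_{B+1} f(· + 1)`, hence `E_{B+1} f - E_B f = ρ E_{B+1} (f(· + 1) - f)`. No coupling is
needed. -/
theorem abs_tsum_negBinom_succ_sub_le {f : ℕ → ℝ} {L : ℝ} (hf : ∀ x, |f (x + 1) - f x| ≤ L)
    (a : Set.Ioo (0 : ℝ) 1) (B : ℕ) :
    |∑' r, negBinom a (B + 1) r * f r - ∑' r, negBinom a B r * f r| ≤ rho a * L := by
  have h0 : 0 < (a : ℝ) := a.2.1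
  have h2 : (0 : ℝ) < 1 - a := by linarith [a.2.2]
  have hf' : ∀ x, |f (x + 1 + 1) - f (x + 1)| ≤ L := fun x => hf (x + 1)
  have s1 := summable_negBinom_mul hf a (B + 1)
  have s0 := summable_negBinom_mul hf a B
  have sτ := summable_negBinom_mul (f := fun r => f (r + 1)) hf' a (B + 1)
  have hrec : ∑' r, negBinom a (B + 1) r * f r =
      a * ∑' r, negBinom a B r * f r + (1 - a) * ∑' r, negBinom a (B + 1) r * f (r + 1) := by
    rw [s1.tsum_eq_zero_add, s0.tsum_eq_zero_add, negBinom_succ_zero]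
    have s0' := (summable_nat_add_iff 1).2 s0
    rw [mul_add, ← tsum_mul_left, ← tsum_mul_left, add_assoc, ← (s0'.mul_left _).tsum_add
      (sτ.mul_left _), mul_assoc]
    congr 2
    funext r
    rw [negBinom_succ_succ]
    ring
  have hd : |∑' r, negBinom a (B + 1) r * (f (r + 1) - f r)| ≤ L := by
    have hs : HasSum (fun r => negBinom a (B + 1) r * L) L := by
      simpa using (hasSum_negBinom a (B + 1)).mul_right L
    rw [← Real.norm_eq_abs]
    refine tsum_of_norm_bounded hs fun r => ?_
    rw [norm_mul, Real.norm_of_nonneg (negBinom_nonneg a _ r)]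
    exact mul_le_mul_of_nonneg_left (hf r) (negBinom_nonneg a _ r)
  have e : ∑' r, negBinom a (B + 1) r * f r - ∑' r, negBinom a B r * f r =
      rho a * ∑' r, negBinom a (B + 1) r * (f (r + 1) - f r) := by
    simp_rw [mul_sub]
    rw [sτ.tsum_sub s1, rho]
    field_simp
    linarith
  rw [e, abs_mul, abs_of_pos (rho_pos a)]
  exact mul_le_mul_of_nonneg_left hd (rho_pos a).le

section

variable {ν : Measure (Set.Ioo (0 : ℝ) 1)} [IsProbabilityMeasure ν]

theorem integrable_negBinom (B r : ℕ) :
    Integrable (fun a : Set.Ioo (0 : ℝ) 1 => negBinom a B r) ν := by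
  refine Integrable.of_bound (C := 1) (measurable_negBinom B r).aestronglyMeasurable
    (ae_of_all _ fun a => ?_)
  rw [Real.norm_of_nonneg (negBinom_nonneg a B r)]
  have := (hasSum_negBinom a B).summable.le_tsum r fun i _ => negBinom_nonneg a B i
  rwa [(hasSum_negBinom a B).tsum_eq] at this

theorem branchingKernel_singleton_eq_lintegral (x y : ℕ) :
    branchingKernel ν x {y} = ∫⁻ a, ENNReal.ofReal (negBinom a (x + 1) y) ∂ν := by
  rw [branchingKernel_singleton, transProb_eq_integral_negBinom,
    ofReal_integral_eq_lintegral_ofReal (integrable_negBinom _ _)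
      (ae_of_all _ fun a => negBinom_nonneg a _ _)]

theorem lintegral_branchingKernel (hρ : Integrable rho ν) (x : ℕ) :
    ∫⁻ y, (y : ℝ≥0∞) ∂(branchingKernel ν x) = ENNReal.ofReal ((∫ a, rho a ∂ν) * (x + 1)) := by
  rw [lintegral_countable', mul_comm, ← integral_const_mul, ofReal_integral_eq_lintegral_ofReal
    (hρ.const_mul _) (ae_of_all _ fun a => mul_nonneg (by positivity) (rho_pos a).le)]
  simp_rw [branchingKernel_singleton_eq_lintegral]
  simp_rw [← lintegral_const_mul _ (measurable_negBinom _ _).ennreal_ofReal]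
  rw [← lintegral_tsum fun y => ((measurable_negBinom _ _).ennreal_ofReal.const_mul _).aemeasurable]
  refine lintegral_congr fun a => ?_
  have h := hasSum_mul_negBinom a (x + 1)
  have e : ((x : ℝ) + 1) * rho a = ((x + 1 : ℕ) : ℝ) * rho a := by push_cast; ring
  rw [e, ← h.tsum_eq, ENNReal.ofReal_tsum_of_nonneg
    (fun y => mul_nonneg (by positivity) (negBinom_nonneg a _ _)) h.summable]
  refine tsum_congr fun y => ?_
  rw [ENNReal.ofReal_mul (by positivity), ENNReal.ofReal_natCast]

theorem integrable_natCast_branchingKernel (hρ : Integrable rho ν) (x : ℕ) :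
    Integrable (fun y : ℕ => (y : ℝ)) (branchingKernel ν x) :=
  integrable_natCast_of_lintegral (by rw [lintegral_branchingKernel hρ]; exact ENNReal.ofReal_ne_top)

theorem hasSum_integral_negBinom (hρ : Integrable rho ν) {f : ℕ → ℝ} {L : ℝ}
    (hf : ∀ x, |f (x + 1) - f x| ≤ L) (B : ℕ) :
    HasSum (fun r => ∫ a : Set.Ioo (0 : ℝ) 1, negBinom a B r * f r ∂ν)
      (∫ a : Set.Ioo (0 : ℝ) 1, ∑' r, negBinom a B r * f r ∂ν) := by
  refine hasSum_integral_of_dominated_convergence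
    (fun r a => |f 0| * negBinom a B r + L * (r * negBinom a B r))
    (fun r => ((measurable_negBinom B r).mul_const _).aestronglyMeasurable)
    (fun r => ae_of_all _ fun a => norm_negBinom_mul_le hf a B r)
    (ae_of_all _ fun a => (hasSum_affine_negBinom a B _ L).summable) ?_
    (ae_of_all _ fun a => (summable_negBinom_mul hf a B).hasSum)
  simp_rw [fun a => (hasSum_affine_negBinom a B (|f 0|) L).tsum_eq]
  exact (integrable_const _).add ((hρ.const_mul _).const_mul _)

theorem integrable_tsum_negBinom (hρ : Integrable rho ν) {f : ℕ → ℝ} {L : ℝ}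
    (hf : ∀ x, |f (x + 1) - f x| ≤ L) (B : ℕ) :
    Integrable (fun a : Set.Ioo (0 : ℝ) 1 => ∑' r, negBinom a B r * f r) ν := by
  have hb : Integrable (fun a => |f 0| + L * (B * rho a)) ν :=
    (integrable_const _).add ((hρ.const_mul _).const_mul _)
  refine hb.mono' ?_ (ae_of_all _ fun a => ?_)
  · exact (Measurable.tsum fun r => (measurable_negBinom B r).mul_const _).aestronglyMeasurable
  · exact tsum_of_norm_bounded (hasSum_affine_negBinom a B (|f 0|) L)
      (norm_negBinom_mul_le hf a B)

theorem integral_branchingKernel (hρ : Integrable rho ν) {f : ℕ → ℝ} {L : ℝ}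
    (hf : ∀ x, |f (x + 1) - f x| ≤ L) (x : ℕ) :
    ∫ y, f y ∂(branchingKernel ν x) =
      ∫ a : Set.Ioo (0 : ℝ) 1, ∑' r, negBinom a (x + 1) r * f r ∂ν := by
  rw [integral_countable (integrable_of_increments hf (integrable_natCast_branchingKernel hρ x)),
    ← (hasSum_integral_negBinom hρ hf (x + 1)).tsum_eq]
  refine tsum_congr fun y => ?_
  rw [integral_mul_const, measureReal_def, branchingKernel_singleton, ENNReal.toReal_ofReal,
    transProb_eq_integral_negBinom, smul_eq_mul]
  rw [transProb_eq_integral_negBinom]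
  exact integral_nonneg fun a => negBinom_nonneg a _ _

/-- From `x` and from `x + 1` the offspring numbers differ, in the same environment, by one
geometric variable of mean `rho a`; it remains to average over `a`. -/
theorem isContracting_branchingKernel (hρ : Integrable rho ν) (h1 : ∫ a, rho a ∂ν < 1) :
    IsContracting (branchingKernel ν) (∫ a, rho a ∂ν) where
  nonneg := integral_nonneg fun a => (rho_pos a).le
  lt_one := h1
  lintegral_le x := (lintegral_branchingKernel hρ x).le
  increments f L hf x := by
    rw [integral_branchingKernel hρ hf, integral_branchingKernel hρ hf,
      ← integral_sub (integrable_tsum_negBinom hρ hf _) (integrable_tsum_negBinom hρ hf _),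
      ← integral_mul_const, ← Real.norm_eq_abs]
    exact norm_integral_le_of_norm_le (hρ.mul_const L)
      (ae_of_all _ fun a => abs_tsum_negBinom_succ_sub_le hf a (x + 1))

/-! ### Bounds on `phi` -/

theorem phi_nonpos (x y : ℕ) : phi ν x y ≤ 0 := by
  have h : ∀ a : Set.Ioo (0 : ℝ) 1,
      0 ≤ (a : ℝ) ^ (x + 1) * (1 - (a : ℝ)) ^ y ∧ (a : ℝ) ^ (x + 1) * (1 - (a : ℝ)) ^ y ≤ 1 := by
    intro a
    have h0 : 0 < (a : ℝ) := a.2.1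
    have h2 : (0 : ℝ) < 1 - a := by linarith [a.2.2]
    exact ⟨by positivity, mul_le_one₀ (pow_le_one₀ h0.le a.2.2.le) (by positivity)
      (pow_le_one₀ h2.le (by linarith))⟩
  refine Real.log_nonpos (integral_nonneg fun a => (h a).1) ?_
  refine (integral_mono (integrable_moment ν x y) (integrable_const 1) fun a => (h a).2).trans ?_
  simp

/-- Jensen's inequality for the exponential bounds `phi` below by `(x + 1) ∫ log a + y ∫ log (1 -
a)`. As `∫ log ρ < 0`, the first mean exceeds the second, so `C` bounds both. -/
theorem le_phi (hl : Integrable (fun a => Real.log (rho a)) ν) (hneg : ∫ a, Real.log (rho a) ∂ν < 0)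
    (hl1 : Integrable (fun a : Set.Ioo (0 : ℝ) 1 => Real.log (1 - (a : ℝ))) ν) {C : ℝ}
    (hC : C ≤ ∫ a : Set.Ioo (0 : ℝ) 1, Real.log (1 - (a : ℝ)) ∂ν) (x y : ℕ) :
    C * (1 + x + y) ≤ phi ν x y := by
  have hpos : ∀ a : Set.Ioo (0 : ℝ) 1, 0 < (a : ℝ) ∧ 0 < 1 - (a : ℝ) := fun a =>
    ⟨a.2.1, by linarith [a.2.2]⟩
  have hlog : ∀ a : Set.Ioo (0 : ℝ) 1,
      Real.log a = Real.log (1 - (a : ℝ)) - Real.log (rho a) := by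
    intro a
    rw [rho, Real.log_div (hpos a).2.ne' (hpos a).1.ne']
    ring
  have hla : Integrable (fun a : Set.Ioo (0 : ℝ) 1 => Real.log (a : ℝ)) ν := by
    simp_rw [hlog]
    exact hl1.sub hl
  have hCa : C ≤ ∫ a : Set.Ioo (0 : ℝ) 1, Real.log (a : ℝ) ∂ν := by
    simp_rw [hlog]
    rw [integral_sub hl1 hl]
    linarith
  have hexp : ∀ a : Set.Ioo (0 : ℝ) 1,
      Real.exp ((x + 1) * Real.log a + y * Real.log (1 - (a : ℝ))) =
        (a : ℝ) ^ (x + 1) * (1 - (a : ℝ)) ^ y := by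
    intro a
    have e := Real.exp_nat_mul (Real.log a) (x + 1)
    push_cast at e
    rw [Real.exp_add, e, Real.exp_nat_mul, Real.exp_log (hpos a).1, Real.exp_log (hpos a).2]
  have hf : Integrable (fun a : Set.Ioo (0 : ℝ) 1 =>
      ((x : ℝ) + 1) * Real.log a + y * Real.log (1 - (a : ℝ))) ν :=
    (hla.const_mul _).add (hl1.const_mul _)
  have hj := convexOn_exp.map_integral_le Real.continuous_exp.continuousOn isClosed_univ
    (ae_of_all _ fun _ => Set.mem_univ _) hf (by
      simp only [Function.comp_def, hexp]
      exact integrable_moment ν x y)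
  simp only [hexp] at hj
  have h2 := Real.log_le_log (Real.exp_pos _) hj
  rw [Real.log_exp, integral_add (hla.const_mul _) (hl1.const_mul _), integral_const_mul,
    integral_const_mul] at h2
  refine le_trans ?_ h2
  have i1 := mul_le_mul_of_nonneg_left hCa (by positivity : (0 : ℝ) ≤ x + 1)
  have i2 := mul_le_mul_of_nonneg_left hC (by positivity : (0 : ℝ) ≤ y)
  linarith

end

/-! ### One step of the walk under the annealed law -/

/-- The infinite path which follows `v` up to time `t` and stays constant afterwards. -/
def extendPath (t : ℕ) (v : Fin (t + 1) → ℤ) : ℕ → ℤ :=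
  fun s => v ⟨min s t, Nat.lt_succ_of_le (min_le_right _ _)⟩

theorem extendPath_apply {t : ℕ} (v : Fin (t + 1) → ℤ) {s : ℕ} (hs : s ≤ t) :
    extendPath t v s = v ⟨s, Nat.lt_succ_of_le hs⟩ := by
  simp only [extendPath, min_eq_left hs]

theorem measurable_coordinate (x : ℤ) : Measurable fun e : Env => (e x : ℝ) :=
  measurable_subtype_coe.comp (measurable_pi_apply x)

theorem measurable_stepProb (x y : ℤ) : Measurable fun e : Env => stepProb e x y := by
  unfold stepProb
  have := measurable_coordinate x
  split_ifs <;> fun_prop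

theorem stepProb_nonneg (e : Env) (x y : ℤ) : 0 ≤ stepProb e x y := by
  unfold stepProb
  split_ifs
  · exact (e x).2.1.le
  · linarith [(e x).2.2]
  · exact le_rfl

theorem measurable_quenchedPathProb (t : ℕ) (x : ℕ → ℤ) :
    Measurable fun e : Env => quenchedPathProb e t x := by
  unfold quenchedPathProb
  split_ifs
  · exact Finset.measurable_fun_prod _ fun s _ => measurable_stepProb _ _
  · exact measurable_const

theorem quenchedPathProb_nonneg (e : Env) (t : ℕ) (x : ℕ → ℤ) : 0 ≤ quenchedPathProb e t x := by
  unfold quenchedPathProb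
  split_ifs
  · exact Finset.prod_nonneg fun s _ => stepProb_nonneg _ _ _
  · exact le_rfl

theorem quenchedPathProb_update (e : Env) (t : ℕ) (x : ℕ → ℤ) (y : ℤ) :
    quenchedPathProb e (t + 1) (Function.update x (t + 1) y) =
      quenchedPathProb e t x * stepProb e (x t) y := by
  unfold quenchedPathProb
  rw [Function.update_of_ne (by omega)]
  split_ifs
  · rw [Finset.prod_range_succ, Function.update_self, Function.update_of_ne (by omega)]
    congr 1
    refine Finset.prod_congr rfl fun s hs => ?_
    have := Finset.mem_range.1 hs
    rw [Function.update_of_ne (by omega), Function.update_of_ne (by omega)]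
  · rw [zero_mul]

namespace IsRandomWalkInRandomEnv

variable {Ω : Type*} {X : ℕ → Ω → ℤ}

/-- The event that the walk follows the path `x` up to time `t`. -/
def cylinder (X : ℕ → Ω → ℤ) (t : ℕ) (x : ℕ → ℤ) : Set Ω := {o | ∀ s ≤ t, X s o = x s}

theorem iUnion_cylinder (t : ℕ) :
    ⋃ v : Fin (t + 1) → ℤ, cylinder X t (extendPath t v) = Set.univ := by
  refine Set.eq_univ_of_forall fun o => Set.mem_iUnion.2 ⟨fun i => X i o, fun s hs => ?_⟩
  rw [extendPath_apply _ hs]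

theorem pairwise_disjoint_cylinder (t : ℕ) :
    Pairwise fun v w : Fin (t + 1) → ℤ =>
      Disjoint (cylinder X t (extendPath t v)) (cylinder X t (extendPath t w)) := by
  intro v w hvw
  refine Set.disjoint_left.2 fun o hv hw => hvw (funext fun i => ?_)
  have hi : (i : ℕ) ≤ t := Nat.le_of_lt_succ i.2
  have h1 := hv i hi
  have h2 := hw i hi
  rw [extendPath_apply _ hi] at h1 h2
  exact h1.symm.trans h2

variable [MeasurableSpace Ω] {P : Measure Ω} {ν : Measure (Set.Ioo (0 : ℝ) 1)} {env : Ω → Env}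

theorem measurableSet_cylinder (hX : IsRandomWalkInRandomEnv P ν env X) (t : ℕ) (x : ℕ → ℤ) :
    MeasurableSet (cylinder X t x) := by
  have : cylinder X t x = ⋂ s, ⋂ (_ : s ≤ t), X s ⁻¹' {x s} := by
    ext o
    simp [cylinder]
  rw [this]
  exact .iInter fun s => .iInter fun _ => hX.measurable_walk s (measurableSet_singleton _)

theorem measurableSet_path (hX : IsRandomWalkInRandomEnv P ν env X) (t : ℕ) (p : (ℕ → ℤ) → Prop)
    (hp : ∀ w w' : ℕ → ℤ, (∀ s ≤ t, w s = w' s) → (p w ↔ p w')) :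
    MeasurableSet {o | p fun s => X s o} := by
  have : {o | p fun s => X s o} = ⋃ v : Fin (t + 1) → ℤ, ⋃ (_ : p (extendPath t v)),
      cylinder X t (extendPath t v) := by
    ext o
    simp only [Set.mem_ofPred_eq, Set.mem_iUnion, exists_prop]
    constructor
    · intro h
      have hv : ∀ s ≤ t, X s o = extendPath t (fun i => X i o) s := fun s hs => by
        rw [extendPath_apply _ hs]
      exact ⟨fun i => X i o, (hp _ _ hv).1 h, hv⟩
    · rintro ⟨v, hv, ho⟩
      exact (hp _ _ ho).2 hv
  rw [this]
  exact .iUnion fun v => .iUnion fun _ => hX.measurableSet_cylinder t _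

/-- The quenched law says that the environment on a cylinder has density `quenchedPathProb`; as an
identity of measures it extends from events to functions. -/
theorem setLIntegral_cylinder (hX : IsRandomWalkInRandomEnv P ν env X) (t : ℕ) (x : ℕ → ℤ)
    {g : Env → ℝ≥0∞} (hg : Measurable g) :
    ∫⁻ o in cylinder X t x, g (env o) ∂P =
      ∫⁻ e, ENNReal.ofReal (quenchedPathProb e t x) * g e ∂(envLaw ν) := by
  have hm : (P.restrict (cylinder X t x)).map env =
      (envLaw ν).withDensity fun e => ENNReal.ofReal (quenchedPathProb e t x) := by
    ext A hA
    rw [Measure.map_apply hX.measurable_env hA,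
      Measure.restrict_apply (hX.measurable_env hA), withDensity_apply _ hA,
      ← hX.quenched_law t x A hA]
    rfl
  rw [← lintegral_map hg hX.measurable_env, hm, lintegral_withDensity_eq_lintegral_mul _
    (measurable_quenchedPathProb t x).ennreal_ofReal hg]
  rfl

theorem setLIntegral_cylinder_step (hX : IsRandomWalkInRandomEnv P ν env X) (t : ℕ) (x : ℕ → ℤ)
    {g : ℤ → Env → ℝ≥0∞} (hg : ∀ y, Measurable (g y)) :
    ∫⁻ o in cylinder X t x, g (X (t + 1) o) (env o) ∂P =
      ∫⁻ o in cylinder X t x, (ENNReal.ofReal (env o (x t)) * g (x t + 1) (env o) +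
        ENNReal.ofReal (1 - env o (x t)) * g (x t - 1) (env o)) ∂P := by
  have hc := measurable_coordinate (x t)
  have e1 : cylinder X t x = ⋃ y : ℤ, cylinder X (t + 1) (Function.update x (t + 1) y) := by
    ext o
    simp only [cylinder, Set.mem_ofPred_eq, Set.mem_iUnion]
    constructor
    · intro h
      refine ⟨X (t + 1) o, fun s hs => ?_⟩
      rcases Nat.le_succ_iff.1 hs with hs | rfl
      · rw [Function.update_of_ne (by omega), h s hs]
      · rw [Function.update_self]
    · rintro ⟨y, h⟩ s hs
      rw [h s (by omega), Function.update_of_ne (by omega)]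
  have hdisj : Pairwise fun y y' : ℤ =>
      Disjoint (cylinder X (t + 1) (Function.update x (t + 1) y))
        (cylinder X (t + 1) (Function.update x (t + 1) y')) := by
    intro y y' hy
    refine Set.disjoint_left.2 fun o h h' => hy ?_
    have h1 := h (t + 1) le_rfl
    have h2 := h' (t + 1) le_rfl
    rw [Function.update_self] at h1 h2
    exact h1.symm.trans h2
  have e2 : ∀ y : ℤ, ∫⁻ o in cylinder X (t + 1) (Function.update x (t + 1) y),
      g (X (t + 1) o) (env o) ∂P = ∫⁻ e, ENNReal.ofReal (quenchedPathProb e t x) *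
        (ENNReal.ofReal (stepProb e (x t) y) * g y e) ∂(envLaw ν) := by
    intro y
    rw [setLIntegral_congr_fun (g := fun o => g y (env o)) (hX.measurableSet_cylinder _ _)
      (fun o ho => ?_), hX.setLIntegral_cylinder _ _ (hg y)]
    · refine lintegral_congr fun e => ?_
      rw [quenchedPathProb_update, ENNReal.ofReal_mul (quenchedPathProb_nonneg _ _ _), mul_assoc]
    · have h1 := ho (t + 1) le_rfl
      rw [Function.update_self] at h1
      simp only [h1]
  have hne : x t + 1 ≠ x t - 1 := by omega
  conv_lhs => rw [e1]
  rw [lintegral_iUnion (fun y => hX.measurableSet_cylinder _ _) hdisj]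
  simp_rw [e2]
  rw [tsum_eq_sum (s := {x t + 1, x t - 1}), Finset.sum_pair hne, hX.setLIntegral_cylinder t x
    (g := fun e => ENNReal.ofReal (e (x t)) * g (x t + 1) e +
      ENNReal.ofReal (1 - e (x t)) * g (x t - 1) e)
    (by have := hg (x t + 1); have := hg (x t - 1); fun_prop), ← lintegral_add_left]
  · refine lintegral_congr fun e => ?_
    rw [← mul_add]
    simp [stepProb, hne.symm]
  · have := measurable_quenchedPathProb t x
    have := measurable_stepProb (x t) (x t + 1)
    have := hg (x t + 1)
    fun_prop
  · intro y hy
    simp only [Finset.mem_insert, Finset.mem_singleton, not_or] at hy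
    simp [stepProb, hy.1, hy.2]

/-- Conditioning on the environment and on the walk up to time `t`. -/
theorem lintegral_step (hX : IsRandomWalkInRandomEnv P ν env X) (t : ℕ)
    {G : (ℕ → ℤ) → ℤ → Env → ℝ≥0∞} (hdep : ∀ w w' : ℕ → ℤ, (∀ s ≤ t, w s = w' s) → G w = G w')
    (hG : ∀ w y, Measurable (G w y)) :
    ∫⁻ o, G (fun s => X s o) (X (t + 1) o) (env o) ∂P =
      ∫⁻ o, (ENNReal.ofReal (env o (X t o)) * G (fun s => X s o) (X t o + 1) (env o) +
        ENNReal.ofReal (1 - env o (X t o)) * G (fun s => X s o) (X t o - 1) (env o)) ∂P := by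
  -- Paths up to time `t` form a countable set, so conditioning on the past is a sum over cylinders.
  have hpart : ∀ f : Ω → ℝ≥0∞, ∫⁻ o, f o ∂P =
      ∑' v : Fin (t + 1) → ℤ, ∫⁻ o in cylinder X t (extendPath t v), f o ∂P := by
    intro f
    rw [← lintegral_iUnion (fun v => hX.measurableSet_cylinder _ _) (pairwise_disjoint_cylinder t),
      iUnion_cylinder, Measure.restrict_univ]
  rw [hpart, hpart]
  refine tsum_congr fun v => ?_
  rw [setLIntegral_congr_fun (g := fun o => G (extendPath t v) (X (t + 1) o) (env o))
    (hX.measurableSet_cylinder _ _) (fun o ho => ?_),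
    hX.setLIntegral_cylinder_step t _ (hG (extendPath t v))]
  · refine setLIntegral_congr_fun (hX.measurableSet_cylinder _ _) fun o ho => ?_
    simp only [ho t le_rfl, hdep (fun s => X s o) _ ho]
  · simp only [hdep (fun s => X s o) _ ho]

theorem ae_start [IsProbabilityMeasure P] [IsProbabilityMeasure ν]
    (hX : IsRandomWalkInRandomEnv P ν env X) : ∀ᵐ o ∂P, X 0 o = 0 := by
  have h := hX.quenched_law 0 (fun _ => 0) Set.univ MeasurableSet.univ
  have : IsProbabilityMeasure (envLaw ν) := by unfold envLaw; infer_instance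
  simp [quenchedPathProb] at h
  refine (mem_ae_iff_prob_eq_one (hX.measurable_walk 0 (measurableSet_singleton 0))).2 h

/-- Apply the one-step formula to the indicator of a forbidden step: it vanishes at both permitted
positions. -/
theorem ae_nearest_neighbour (hX : IsRandomWalkInRandomEnv P ν env X) :
    ∀ᵐ o ∂P, ∀ t, X (t + 1) o = X t o + 1 ∨ X (t + 1) o = X t o - 1 := by
  refine ae_all_iff.2 fun t => ?_
  have h := hX.lintegral_step t
    (G := fun w y _ => if y = w t + 1 ∨ y = w t - 1 then 0 else 1)
    (fun w w' hw => by simp only [hw t le_rfl]) (fun w y => measurable_const)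
  simp only [true_or, or_true, if_true, mul_zero, add_zero, lintegral_zero] at h
  have hm : Measurable fun o => if X (t + 1) o = X t o + 1 ∨ X (t + 1) o = X t o - 1
      then (0 : ℝ≥0∞) else 1 := by
    refine Measurable.ite ?_ measurable_const measurable_const
    have h1 := hX.measurable_walk t
    have h2 := hX.measurable_walk (t + 1)
    exact (measurableSet_eq_fun h2 (h1.add_const 1)).union
      (measurableSet_eq_fun h2 (h1.sub_const 1))
  filter_upwards [(lintegral_eq_zero_iff hm).1 h] with o ho
  by_contra hne
  simp [hne] at ho

end IsRandomWalkInRandomEnv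

/-! ### The walk hits every site on the right -/

theorem lintegral_prod_envLaw (ν : Measure (Set.Ioo (0 : ℝ) 1)) [IsProbabilityMeasure ν]
    {σ : ℕ → ℤ} (hσ : Function.Injective σ) (k : ℕ) {f : ℕ → Set.Ioo (0 : ℝ) 1 → ℝ≥0∞}
    (hf : ∀ i, Measurable (f i)) :
    ∫⁻ e, ∏ i ∈ Finset.range k, f i (e (σ i)) ∂(envLaw ν) =
      ∏ i ∈ Finset.range k, ∫⁻ a, f i a ∂ν := by
  have hind : iIndepFun (fun (i : ℕ) (e : Env) => f i (e (σ i))) (envLaw ν) := by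
    have h := iIndepFun_infinitePi (P := fun _ : ℤ => ν) (X := fun _ => id)
      (fun _ => measurable_id)
    exact (h.precomp hσ).comp f hf
  rw [lintegral_prod_eq_prod_lintegral_of_indepFun _ _ hind
    fun i => (hf i).comp (measurable_pi_apply _)]
  refine Finset.prod_congr rfl fun i _ => ?_
  have h := (measurePreserving_eval_infinitePi (fun _ : ℤ => ν) (σ i))
  exact h.lintegral_comp (hf i)

/-- `ρ` as an extended nonnegative number. -/
noncomputable def rhoENN (a : Set.Ioo (0 : ℝ) 1) : ℝ≥0∞ := ENNReal.ofReal (rho a)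

theorem measurable_rhoENN : Measurable rhoENN := measurable_rho.ennreal_ofReal

theorem ofReal_mul_one_add_rhoENN (a : Set.Ioo (0 : ℝ) 1) :
    ENNReal.ofReal a * (1 + rhoENN a) = 1 := by
  have h0 : 0 < (a : ℝ) := a.2.1
  rw [rhoENN, ← ENNReal.ofReal_one, ← ENNReal.ofReal_add zero_le_one (rho_pos a).le,
    ← ENNReal.ofReal_mul h0.le, rho]
  congr 1
  field_simp
  ring

theorem ofReal_mul_rhoENN (a : Set.Ioo (0 : ℝ) 1) :
    ENNReal.ofReal a * rhoENN a = ENNReal.ofReal (1 - a) := by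
  have h0 : 0 < (a : ℝ) := a.2.1
  rw [rhoENN, ← ENNReal.ofReal_mul h0.le, rho]
  congr 1
  field_simp

theorem ofReal_add_ofReal_one_sub (a : Set.Ioo (0 : ℝ) 1) :
    ENNReal.ofReal a + ENNReal.ofReal (1 - a) = 1 := by
  have h0 : 0 < (a : ℝ) := a.2.1
  rw [← ENNReal.ofReal_add h0.le (by linarith [a.2.2]), add_sub_cancel, ENNReal.ofReal_one]

/-- Quenched mean of the time needed to go from `j` to `j + 1`. -/
noncomputable def crossingTime (e : Env) (j : ℤ) : ℝ≥0∞ :=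
  ∑' k : ℕ, (∏ i ∈ Finset.range k, rhoENN (e (j - i))) * (1 + rhoENN (e (j - k)))

theorem measurable_rhoENN_coordinate (x : ℤ) : Measurable fun e : Env => rhoENN (e x) :=
  measurable_rhoENN.comp (measurable_pi_apply x)

theorem measurable_prod_rhoENN (j : ℤ) (k : ℕ) :
    Measurable fun e : Env => ∏ i ∈ Finset.range k, rhoENN (e (j - i)) :=
  Finset.measurable_fun_prod _ fun _ _ => measurable_rhoENN_coordinate _

theorem measurable_crossingTime (j : ℤ) : Measurable fun e => crossingTime e j := by
  refine Measurable.tsum fun k => (measurable_prod_rhoENN j k).mul ?_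
  exact (measurable_rhoENN_coordinate _).const_add 1

theorem crossingTime_eq (e : Env) (j : ℤ) :
    crossingTime e j = (1 + rhoENN (e j)) + rhoENN (e j) * crossingTime e (j - 1) := by
  unfold crossingTime
  rw [tsum_eq_zero_add' ENNReal.summable, ← ENNReal.tsum_mul_left]
  refine congrArg₂ (· + ·) ?_ ?_
  · simp
  · refine tsum_congr fun k => ?_
    rw [Finset.prod_range_succ', mul_comm _ (rhoENN (e (j - ((0 : ℕ) : ℤ)))), mul_assoc]
    simp only [Nat.cast_zero, sub_zero, Nat.cast_add, Nat.cast_one, sub_sub, add_comm (1 : ℤ)]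

/-- By independence the products of `k` factors have mean `m ^ k`, so the series is geometric; this
is where ballisticity enters. -/
theorem lintegral_crossingTime_lt_top {ν : Measure (Set.Ioo (0 : ℝ) 1)} [IsProbabilityMeasure ν]
    (hρ : Integrable rho ν) (h1 : ∫ a, rho a ∂ν < 1) (j : ℤ) :
    ∫⁻ e, crossingTime e j ∂(envLaw ν) < ∞ := by
  have hm : ∫⁻ a, rhoENN a ∂ν = ENNReal.ofReal (∫ a, rho a ∂ν) :=
    (ofReal_integral_eq_lintegral_ofReal hρ (ae_of_all _ fun a => (rho_pos a).le)).symm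
  have hprod : ∀ k : ℕ, ∫⁻ e : Env, ∏ i ∈ Finset.range k, rhoENN (e (j - i)) ∂(envLaw ν) =
      ENNReal.ofReal (∫ a, rho a ∂ν) ^ k := by
    intro k
    rw [lintegral_prod_envLaw ν (σ := fun i : ℕ => j - i) (fun a b hab => by simpa using hab) k
      (f := fun _ => rhoENN) fun _ => measurable_rhoENN]
    simp [hm]
  have e : ∀ e' : Env, crossingTime e' j =
      ∑' k : ℕ, (∏ i ∈ Finset.range k, rhoENN (e' (j - i)) +
        ∏ i ∈ Finset.range (k + 1), rhoENN (e' (j - i))) := fun e' =>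
    tsum_congr fun k => by rw [Finset.prod_range_succ, mul_add, mul_one]
  simp_rw [e]
  have hmeas : ∀ k : ℕ, AEMeasurable (fun e : Env => ∏ i ∈ Finset.range k, rhoENN (e (j - i)) +
      ∏ i ∈ Finset.range (k + 1), rhoENN (e (j - i))) (envLaw ν) := fun k =>
    ((measurable_prod_rhoENN j k).add (measurable_prod_rhoENN j (k + 1))).aemeasurable
  rw [lintegral_tsum hmeas]
  simp_rw [fun k => lintegral_add_left (μ := envLaw ν) (measurable_prod_rhoENN j k)
    (fun e => ∏ i ∈ Finset.range (k + 1), rhoENN (e (j - i))), hprod]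
  rw [ENNReal.tsum_add]
  simp_rw [pow_succ, ENNReal.tsum_mul_right, ENNReal.tsum_geometric]
  have hlt : 1 - ENNReal.ofReal (∫ a, rho a ∂ν) ≠ 0 := by
    rw [Ne, tsub_eq_zero_iff_le, not_le, ← ENNReal.ofReal_one]
    exact (ENNReal.ofReal_lt_ofReal_iff one_pos).2 h1
  have hinv : (1 - ENNReal.ofReal (∫ a, rho a ∂ν))⁻¹ < ∞ := by
    rw [ENNReal.inv_lt_top]
    exact pos_iff_ne_zero.2 hlt
  exact ENNReal.add_lt_top.2 ⟨hinv, ENNReal.mul_lt_top hinv ENNReal.ofReal_lt_top⟩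

/-- Quenched mean of the time needed to go from `x` to `n`. -/
noncomputable def travelTime (n : ℤ) (e : Env) (x : ℤ) : ℝ≥0∞ :=
  ∑ i ∈ Finset.range (n - x).toNat, crossingTime e (n - 1 - i)

theorem measurable_travelTime (n x : ℤ) : Measurable fun e => travelTime n e x :=
  Finset.measurable_fun_sum _ fun _ _ => measurable_crossingTime _

theorem travelTime_of_lt {n x : ℤ} (hx : x < n) (e : Env) :
    travelTime n e x = travelTime n e (x + 1) + crossingTime e x := by
  unfold travelTime
  have : (n - x).toNat = (n - (x + 1)).toNat + 1 := by omega
  rw [this, Finset.sum_range_succ]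
  congr 2
  omega

/-- First-step analysis of the mean hitting time. Subtraction is avoided, as crossing times may be
infinite: the input is `p * D = 1 + q * D'` for consecutive crossing times. -/
theorem travelTime_step {n x : ℤ} (hx : x < n) (e : Env) :
    ENNReal.ofReal (e x) * (travelTime n e (x + 1) + 1) +
      ENNReal.ofReal (1 - e x) * (travelTime n e (x - 1) + 1) = travelTime n e x := by
  have hpq := ofReal_add_ofReal_one_sub (e x)
  have h1 := travelTime_of_lt (show x - 1 < n by omega) e
  rw [sub_add_cancel] at h1
  rw [h1, travelTime_of_lt hx e]
  set p := ENNReal.ofReal (e x)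
  set q := ENNReal.ofReal (1 - e x)
  set S := travelTime n e (x + 1)
  set D := crossingTime e x with hD
  set D' := crossingTime e (x - 1) with hD'
  have hpD : p * D = 1 + q * D' := by
    rw [hD, crossingTime_eq, ← hD', mul_add, ← mul_assoc]
    rw [ofReal_mul_one_add_rhoENN, ofReal_mul_rhoENN]
  calc p * (S + 1) + q * (S + D + D' + 1) = (p + q) * S + (p + q) + q * D + q * D' := by ring
    _ = S + (1 + q * D') + q * D := by rw [hpq]; ring
    _ = S + (p + q) * D := by rw [← hpD]; ring
    _ = S + D := by rw [hpq, one_mul]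

theorem lintegral_travelTime_lt_top {ν : Measure (Set.Ioo (0 : ℝ) 1)} [IsProbabilityMeasure ν]
    (hρ : Integrable rho ν) (h1 : ∫ a, rho a ∂ν < 1) (n x : ℤ) :
    ∫⁻ e, travelTime n e x ∂(envLaw ν) < ∞ := by
  unfold travelTime
  rw [lintegral_finsetSum _ fun i _ => measurable_crossingTime _]
  exact ENNReal.sum_lt_top.2 fun i _ => lintegral_crossingTime_lt_top hρ h1 _

namespace IsRandomWalkInRandomEnv

variable {Ω : Type*} {X : ℕ → Ω → ℤ} [MeasurableSpace Ω] {P : Measure Ω}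
  {ν : Measure (Set.Ioo (0 : ℝ) 1)} {env : Ω → Env}

/-- The expected remaining time drops by at least one unit for each step taken before reaching `n`.
-/
theorem lintegral_travelTime_step (hX : IsRandomWalkInRandomEnv P ν env X) (n : ℤ) (t : ℕ) :
    (∫⁻ o, {o | ∀ s ≤ t + 1, X s o < n}.indicator
        (fun o => travelTime n (env o) (X (t + 1) o)) o ∂P) + P {o | ∀ s ≤ t, X s o < n} ≤
      ∫⁻ o, {o | ∀ s ≤ t, X s o < n}.indicator (fun o => travelTime n (env o) (X t o)) o ∂P := by
  classical
  have hmeas : MeasurableSet {o | ∀ s ≤ t, X s o < n} :=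
    hX.measurableSet_path t (fun w => ∀ s ≤ t, w s < n)
      fun w w' hw => forall₂_congr fun s hs => by rw [hw s hs]
  have h := hX.lintegral_step t
    (G := fun w y e => if ∀ s ≤ t, w s < n then travelTime n e y + 1 else 0)
    (fun w w' hw => by
      have : (∀ s ≤ t, w s < n) ↔ ∀ s ≤ t, w' s < n := forall₂_congr fun s hs => by rw [hw s hs]
      simp only [this])
    (fun w y => by
      split_ifs
      · exact (measurable_travelTime n y).add_const 1
      · exact measurable_const)
  rw [← lintegral_indicator_one hmeas]
  refine (le_lintegral_add _ _).trans ((lintegral_mono fun o => ?_).trans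
    (h.trans_le (lintegral_mono fun o => ?_)))
  · by_cases ho : ∀ s ≤ t, X s o < n
    · simp only [if_pos ho]
      refine add_le_add (Set.indicator_le_self' (fun _ _ => zero_le) o) ?_
      simp only [Set.indicator]
      split_ifs <;> simp
    · have ho' : ¬ ∀ s ≤ t + 1, X s o < n := fun h' => ho fun s hs => h' s (by omega)
      simp [ho, ho']
  · by_cases ho : ∀ s ≤ t, X s o < n
    · simp only [if_pos ho]
      rw [Set.indicator_of_mem (show o ∈ {o | ∀ s ≤ t, X s o < n} from ho),
        travelTime_step (ho t le_rfl)]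
    · simp [ho]

/-- Telescoping the drop of the expected remaining time gives `N * P S ≤ E[travelTime]` for all `N`,
with a finite right-hand side. So the walk reaches `[n, ∞)`, and unit steps make it enter at `n`. -/
theorem ae_exists_eq [IsProbabilityMeasure P] [IsProbabilityMeasure ν]
    (hX : IsRandomWalkInRandomEnv P ν env X) (hρ : Integrable rho ν) (h1 : ∫ a, rho a ∂ν < 1)
    (n : ℕ) : ∀ᵐ o ∂P, ∃ t, X t o = n := by
  set S : Set Ω := {o | ∀ s, X s o < n} with hS
  have hsum : ∀ N : ℕ, (∫⁻ o, {o | ∀ s ≤ N, X s o < n}.indicator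
      (fun o => travelTime n (env o) (X N o)) o ∂P) + N * P S ≤
        ∫⁻ e, travelTime n e 0 ∂(envLaw ν) := by
    intro N
    induction N with
    | zero =>
      rw [← hX.map_env, lintegral_map (measurable_travelTime n 0) hX.measurable_env]
      simp only [Nat.cast_zero, zero_mul, add_zero]
      refine lintegral_mono_ae ?_
      filter_upwards [hX.ae_start] with o ho
      rw [← ho]
      exact Set.indicator_le_self' (fun _ _ => zero_le) o
    | succ N ih =>
      refine le_trans ?_ ((add_le_add_left (hX.lintegral_travelTime_step n N) (N * P S)).trans ih)
      rw [add_assoc]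
      refine add_le_add le_rfl ?_
      push_cast
      rw [add_mul, one_mul, add_comm]
      gcongr
      exact fun o ho s _ => ho s
  have hfin := lintegral_travelTime_lt_top hρ h1 (n : ℤ) 0
  have hP : P S = 0 := by
    by_contra hne
    have htop : Tendsto (fun N : ℕ => (N : ℝ≥0∞) * P S) atTop (𝓝 (∞ * P S)) :=
      ENNReal.Tendsto.mul_const ENNReal.tendsto_nat_nhds_top (Or.inl (by simp))
    rw [ENNReal.top_mul hne] at htop
    exact hfin.not_ge (le_of_tendsto' htop fun N => le_add_self.trans (hsum N))
  filter_upwards [hX.ae_start, hX.ae_nearest_neighbour, measure_eq_zero_iff_ae_notMem.1 hP]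
    with o h0 hnn hnS
  simp only [hS, Set.mem_ofPred_eq, not_forall, not_lt] at hnS
  classical
  refine ⟨Nat.find hnS, ?_⟩
  have hge := Nat.find_spec hnS
  rcases h : Nat.find hnS with _ | t
  · rw [h] at hge
    omega
  · have hlt : X t o < n := not_le.1 (Nat.find_min hnS (by omega))
    rw [h] at hge
    rcases hnn t with h' | h' <;> omega

end IsRandomWalkInRandomEnv

/-! ### Left steps of the walk and the branching process -/

/-- Quenched probability that a walk at `p`, which has performed `c x` left steps from each site
`x ∈ {0, …, n - 1}`, hits `n` having performed `z x` left steps from each of these sites. -/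
noncomputable def completionProb (n : ℕ) (z : ℕ → ℕ) (e : Env) (p : ℤ) (c : ℕ → ℕ) : ℝ≥0∞ :=
  open Classical in
  if ∀ x < n, c x ≤ z x then
    ∏ x ∈ Finset.range n, ENNReal.ofReal (negBinom (e x)
      ((z (x + 1) - c (x + 1)) + if p ≤ x then 1 else 0) (z x - c x))
  else 0

theorem measurable_completionProb (n : ℕ) (z : ℕ → ℕ) (p : ℤ) (c : ℕ → ℕ) :
    Measurable fun e => completionProb n z e p c := by
  unfold completionProb
  split_ifs
  · exact Finset.measurable_fun_prod _ fun x _ =>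
      ((measurable_negBinom _ _).comp (measurable_pi_apply (x : ℤ))).ennreal_ofReal
  · exact measurable_const

/-- The counts `c` after one more left step from `p`. -/
def addLeftStep (c : ℕ → ℕ) (p : ℤ) (x : ℕ) : ℕ := if (x : ℤ) = p then c x + 1 else c x

/-- A step from outside `{0, …, n}` changes neither the counts nor the side on which the walk lies
of any site that occurs in the product. -/
theorem completionProb_step_of_outside {n : ℕ} {p : ℤ} (hp : p < 0 ∨ n < p) (z : ℕ → ℕ) (e : Env)
    (c : ℕ → ℕ) :
    ENNReal.ofReal (e p) * completionProb n z e (p + 1) c +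
      ENNReal.ofReal (1 - e p) * completionProb n z e (p - 1) (addLeftStep c p) =
        completionProb n z e p c := by
  have h1 : completionProb n z e (p + 1) c = completionProb n z e p c := by
    unfold completionProb
    congr 1
    refine Finset.prod_congr rfl fun x hx => ?_
    have hx := Finset.mem_range.1 hx
    have : p + 1 ≤ (x : ℤ) ↔ p ≤ x := by omega
    simp only [this]
  have h2 : completionProb n z e (p - 1) (addLeftStep c p) = completionProb n z e p c := by
    have hc : ∀ x ≤ n, addLeftStep c p x = c x := fun x hx => if_neg (by omega)
    unfold completionProb
    have h3 : (∀ x < n, addLeftStep c p x ≤ z x) ↔ ∀ x < n, c x ≤ z x :=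
      forall₂_congr fun x hx => by rw [hc x hx.le]
    simp only [h3]
    congr 1
    refine Finset.prod_congr rfl fun x hx => ?_
    have hx := Finset.mem_range.1 hx
    have : p - 1 ≤ (x : ℤ) ↔ p ≤ x := by omega
    simp only [this, hc x hx.le, hc (x + 1) hx]
  rw [h1, h2, ← add_mul, ofReal_add_ofReal_one_sub, one_mul]

/-- Future right steps from `x` number the future left steps from `x + 1`, plus one if the walk is
still at or left of `x`; the left steps from `x` are failures before these successes. A step from
`k` is one trial at `k`, so only the factor at `k` changes, by the negative binomial recursion. -/
theorem completionProb_step_of_inside {n k : ℕ} (hk : k < n) (z : ℕ → ℕ) (e : Env)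
    (c : ℕ → ℕ) :
    ENNReal.ofReal (e k) * completionProb n z e (k + 1) c +
      ENNReal.ofReal (1 - e k) * completionProb n z e (k - 1) (addLeftStep c k) ≤
        completionProb n z e k c := by
  have hc : ∀ x, x ≠ k → addLeftStep c k x = c x := fun x hx => if_neg (by omega)
  have hck : addLeftStep c k k = c k + 1 := if_pos rfl
  have hmem : k ∈ Finset.range n := Finset.mem_range.2 hk
  have he0 : 0 ≤ (e k : ℝ) := (e k).2.1.le
  have he1 : 0 ≤ 1 - (e k : ℝ) := by linarith [(e k).2.2]
  by_cases hcz : ∀ x < n, c x ≤ z x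
  · set A : ℝ≥0∞ := ∏ x ∈ (Finset.range n).erase k, ENNReal.ofReal (negBinom (e x)
      ((z (x + 1) - c (x + 1)) + if (k : ℤ) ≤ x then 1 else 0) (z x - c x)) with hA
    have h0 : completionProb n z e k c =
        ENNReal.ofReal (negBinom (e k) (z (k + 1) - c (k + 1) + 1) (z k - c k)) * A := by
      unfold completionProb
      rw [if_pos hcz, ← Finset.mul_prod_erase _ _ hmem, if_pos le_rfl]
    have h1 : completionProb n z e (k + 1) c =
        ENNReal.ofReal (negBinom (e k) (z (k + 1) - c (k + 1)) (z k - c k)) * A := by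
      unfold completionProb
      rw [if_pos hcz, ← Finset.mul_prod_erase _ _ hmem, if_neg (by omega), add_zero]
      congr 1
      refine Finset.prod_congr rfl fun x hx => ?_
      have hx := Finset.ne_of_mem_erase hx
      have : (k : ℤ) + 1 ≤ (x : ℤ) ↔ (k : ℤ) ≤ x := by omega
      simp only [this]
    rcases Nat.eq_zero_or_pos (z k - c k) with hr | hr
    · have h2 : completionProb n z e (k - 1) (addLeftStep c k) = 0 := by
        unfold completionProb
        refine if_neg fun h => ?_
        have := h k hk
        omega
      rw [h0, h1, h2, hr, mul_zero, add_zero, negBinom_succ_zero, ENNReal.ofReal_mul he0, mul_assoc]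
    · obtain ⟨r, hr⟩ := Nat.exists_eq_add_of_lt hr
      rw [zero_add] at hr
      have h2 : completionProb n z e (k - 1) (addLeftStep c k) =
          ENNReal.ofReal (negBinom (e k) (z (k + 1) - c (k + 1) + 1) r) * A := by
        unfold completionProb
        rw [if_pos, ← Finset.mul_prod_erase _ _ hmem, if_pos (by omega), hck, hc _ (by omega)]
        · congr 1
          · congr 2
            omega
          refine Finset.prod_congr rfl fun x hx => ?_
          have hx := Finset.ne_of_mem_erase hx
          rw [hc x hx]
          -- At site `k - 1` one fewer left step from `k` is pending, but the walk now has to cross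
          -- `k - 1` again: the two changes cancel.
          by_cases hxk : x + 1 = k
          · rw [hxk, hck, if_pos (by omega), if_neg (by omega)]
            congr 2
            omega
          · have : (k : ℤ) - 1 ≤ (x : ℤ) ↔ (k : ℤ) ≤ x := by omega
            simp only [this, hc _ hxk]
        · intro x hx
          by_cases hxk : x = k
          · subst hxk
            omega
          · rw [hc x hxk]
            exact hcz x hx
      rw [h0, h1, h2, hr, negBinom_succ_succ, ENNReal.ofReal_add
        (mul_nonneg he0 (negBinom_nonneg _ _ _)) (mul_nonneg he1 (negBinom_nonneg _ _ _)),
        ENNReal.ofReal_mul he0, ENNReal.ofReal_mul he1, add_mul, mul_assoc, mul_assoc]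
  · have h1 : completionProb n z e (k + 1) c = 0 := if_neg hcz
    have h2 : completionProb n z e (k - 1) (addLeftStep c k) = 0 := by
      refine if_neg fun h => hcz fun x hx => le_trans ?_ (h x hx)
      unfold addLeftStep
      split_ifs <;> omega
    rw [h1, h2]
    simp

theorem completionProb_step {n : ℕ} {p : ℤ} (hp : p ≠ n) (z : ℕ → ℕ) (e : Env) (c : ℕ → ℕ) :
    ENNReal.ofReal (e p) * completionProb n z e (p + 1) c +
      ENNReal.ofReal (1 - e p) * completionProb n z e (p - 1) (addLeftStep c p) ≤
        completionProb n z e p c := by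
  by_cases h : p < 0 ∨ n < p
  · exact (completionProb_step_of_outside h z e c).le
  · lift p to ℕ using by omega
    exact completionProb_step_of_inside (by omega) z e c

theorem completionProb_of_eq {n : ℕ} {z : ℕ → ℕ} (hz : z n = 0) (e : Env) {c : ℕ → ℕ}
    (hc : ∀ x < n, c x = z x) : completionProb n z e n c = 1 := by
  unfold completionProb
  rw [if_pos fun x hx => (hc x hx).le]
  refine Finset.prod_eq_one fun x hx => ?_
  have hx := Finset.mem_range.1 hx
  rw [if_neg (by omega), hc x hx, Nat.sub_self]
  have : z (x + 1) - c (x + 1) = 0 := by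
    rcases Nat.lt_or_ge (x + 1) n with h | h
    · rw [hc _ h, Nat.sub_self]
    · have : x + 1 = n := by omega
      rw [this, hz, Nat.zero_sub]
  simp [this, negBinom]

/-- At time `0` the supermartingale is the product of the quenched transition probabilities of the
branching process, whose mean is a product of entries of `Q`. -/
theorem completionProb_zero (n : ℕ) (z : ℕ → ℕ) (e : Env) :
    completionProb n z e 0 (fun _ => 0) =
      ∏ x ∈ Finset.range n, ENNReal.ofReal (negBinom (e x) (z (x + 1) + 1) (z x)) := by
  unfold completionProb
  rw [if_pos fun x _ => Nat.zero_le _]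
  refine Finset.prod_congr rfl fun x _ => ?_
  rw [if_pos (by omega)]
  simp

theorem leftSteps_succ (w : ℕ → ℤ) (t : ℕ) (z : ℤ) :
    leftSteps w (t + 1) z = leftSteps w t z + if w t = z ∧ w (t + 1) = z - 1 then 1 else 0 := by
  unfold leftSteps
  rw [Finset.range_add_one, Finset.filter_insert]
  split_ifs with h
  · rw [Finset.card_insert_of_notMem (by simp)]
  · rw [add_zero]

theorem leftSteps_congr {w w' : ℕ → ℤ} {t : ℕ} (h : ∀ s ≤ t, w s = w' s) (z : ℤ) :
    leftSteps w t z = leftSteps w' t z := by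
  unfold leftSteps
  congr 1
  refine Finset.filter_congr fun s hs => ?_
  have := Finset.mem_range.1 hs
  rw [h s (by omega), h (s + 1) (by omega)]

/-- The path `w` hits `n` for the first time at time `t`, having performed `z x` left steps from
each site `x ∈ {0, …, n - 1}`. -/
def HitsWith (n : ℕ) (z : ℕ → ℕ) (t : ℕ) (w : ℕ → ℤ) : Prop :=
  (∀ s < t, w s ≠ n) ∧ w t = n ∧ ∀ x < n, leftSteps w t (x : ℕ) = z x

theorem hitsWith_congr {n : ℕ} {z : ℕ → ℕ} {t : ℕ} {w w' : ℕ → ℤ} (h : ∀ s ≤ t, w s = w' s) :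
    HitsWith n z t w ↔ HitsWith n z t w' := by
  unfold HitsWith
  rw [h t le_rfl]
  simp only [leftSteps_congr h]
  have : (∀ s < t, w s ≠ n) ↔ ∀ s < t, w' s ≠ n := forall₂_congr fun s hs => by rw [h s hs.le]
  rw [this]

/-- The numbers of left steps from the sites `n - 1, …, 0` before the walk hits `n`. -/
noncomputable def leftStepsVec (n : ℕ) (w : ℕ → ℤ) (i : Fin n) : ℕ := leftStepsUntilHit w n ((n - 1 - i : ℕ) : ℤ)

open Classical in
theorem ite_hitsWith_add_le {n : ℕ} {z : ℕ → ℕ} (hz : z n = 0) (e : Env) (t : ℕ) (w : ℕ → ℤ) :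
    (if HitsWith n z t w then 1 else 0) +
      (if ∀ s ≤ t, w s ≠ n then
        completionProb n z e (w t) (fun x => leftSteps w t (x : ℕ)) else 0) ≤
      completionProb n z e (w t) (fun x => leftSteps w t (x : ℕ)) := by
  by_cases hn : w t = n
  · rw [if_neg fun h : ∀ s ≤ t, w s ≠ n => h t le_rfl hn, add_zero, hn]
    split_ifs with h
    · rw [completionProb_of_eq hz e h.2.2]
    · exact zero_le
  · rw [if_neg fun h : HitsWith n z t w => hn h.2.1, zero_add]
    split_ifs
    · exact le_rfl
    · exact zero_le

namespace IsRandomWalkInRandomEnv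

variable {Ω : Type*} {X : ℕ → Ω → ℤ} [MeasurableSpace Ω] {P : Measure Ω}
  {ν : Measure (Set.Ioo (0 : ℝ) 1)} {env : Ω → Env}

/-- Expectation of `completionProb` on the event that `n` has not been hit up to time `t`. -/
noncomputable def pendingProb (P : Measure Ω) (env : Ω → Env) (X : ℕ → Ω → ℤ) (n : ℕ) (z : ℕ → ℕ)
    (t : ℕ) : ℝ≥0∞ :=
  ∫⁻ o, {o | ∀ s ≤ t, X s o ≠ n}.indicator (fun o => completionProb n z (env o) (X t o)
    fun x => leftSteps (fun s => X s o) t (x : ℕ)) o ∂P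

theorem measurableSet_hitsWith (hX : IsRandomWalkInRandomEnv P ν env X) (n : ℕ) (z : ℕ → ℕ)
    (t : ℕ) : MeasurableSet {o | HitsWith n z t fun s => X s o} :=
  hX.measurableSet_path t _ fun _ _ h => hitsWith_congr h

/-- Supermartingale step: the pending mass at time `t` pays for the successes at time `t + 1` and
for the mass still pending. -/
theorem measure_hitsWith_succ_add_le (hX : IsRandomWalkInRandomEnv P ν env X) {n : ℕ} {z : ℕ → ℕ}
    (hz : z n = 0) (t : ℕ) :
    P {o | HitsWith n z (t + 1) fun s => X s o} + pendingProb P env X n z (t + 1) ≤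
      pendingProb P env X n z t := by
  classical
  have h := hX.lintegral_step t
    (G := fun w y e => if ∀ s ≤ t, w s ≠ n then completionProb n z e y (fun x =>
      leftSteps w t (x : ℕ) + if w t = (x : ℕ) ∧ y = (x : ℕ) - 1 then 1 else 0) else 0)
    (fun w w' hw => by
      have : (∀ s ≤ t, w s ≠ n) ↔ ∀ s ≤ t, w' s ≠ n := forall₂_congr fun s hs => by rw [hw s hs]
      simp only [this, leftSteps_congr hw, hw t le_rfl])
    (fun w y => by
      split_ifs
      · exact measurable_completionProb _ _ _ _
      · exact measurable_const)
  rw [← lintegral_indicator_one (hX.measurableSet_hitsWith n z (t + 1))]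
  refine (le_lintegral_add _ _).trans ((lintegral_mono fun o => ?_).trans
    (h.trans_le (lintegral_mono fun o => ?_)))
  · by_cases ho : ∀ s ≤ t, X s o ≠ n
    · simp only [if_pos ho, ← leftSteps_succ (fun s => X s o) t]
      have h2 := ite_hitsWith_add_le hz (env o) (t + 1) fun s => X s o
      simpa only [Set.indicator_apply, Set.mem_ofPred_eq, Pi.one_apply] using h2
    · have ho' : o ∉ {o | ∀ s ≤ t + 1, X s o ≠ n} := fun h' => ho fun s hs => h' s (by omega)
      have ho2 : o ∉ {o | HitsWith n z (t + 1) fun s => X s o} :=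
        fun h' => ho fun s hs => h'.1 s (by omega)
      rw [Set.indicator_of_notMem ho', Set.indicator_of_notMem ho2]
      simp
  · by_cases ho : ∀ s ≤ t, X s o ≠ n
    · simp only [if_pos ho]
      rw [Set.indicator_of_mem (show o ∈ {o | ∀ s ≤ t, X s o ≠ n} from ho)]
      refine le_trans (le_of_eq ?_) (completionProb_step (ho t le_rfl) z (env o) _)
      congr 3
      · funext x
        rw [if_neg (by omega), add_zero]
      · funext x
        unfold addLeftStep
        have : (X t o = (x : ℕ) ∧ X t o - 1 = (x : ℕ) - 1) ↔ ((x : ℕ) : ℤ) = X t o := by omega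
        simp only [this]
        split_ifs <;> rfl
    · simp [ho]

theorem measure_hitsWith_zero_add_le [IsProbabilityMeasure P] [IsProbabilityMeasure ν]
    (hX : IsRandomWalkInRandomEnv P ν env X) {n : ℕ} {z : ℕ → ℕ} (hz : z n = 0) :
    P {o | HitsWith n z 0 fun s => X s o} + pendingProb P env X n z 0 ≤
      ∏ x ∈ Finset.range n, branchingKernel ν (z (x + 1)) {z x} := by
  classical
  have e : ∏ x ∈ Finset.range n, branchingKernel ν (z (x + 1)) {z x} =
      ∫⁻ o, completionProb n z (env o) 0 (fun _ => 0) ∂P := by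
    rw [← lintegral_map (measurable_completionProb n z 0 _) hX.measurable_env, hX.map_env]
    simp_rw [completionProb_zero, branchingKernel_singleton_eq_lintegral]
    rw [lintegral_prod_envLaw ν Nat.cast_injective n
      (f := fun x a => ENNReal.ofReal (negBinom a (z (x + 1) + 1) (z x)))
      fun x => (measurable_negBinom _ _).ennreal_ofReal]
  rw [e, ← lintegral_indicator_one (hX.measurableSet_hitsWith n z 0)]
  refine (le_lintegral_add _ _).trans (lintegral_mono_ae ?_)
  filter_upwards [hX.ae_start] with o ho
  have h2 := ite_hitsWith_add_le hz (env o) 0 fun s => X s o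
  have h3 : completionProb n z (env o) (X 0 o) (fun x => leftSteps (fun s => X s o) 0 (x : ℕ)) =
      completionProb n z (env o) 0 fun _ => 0 := by
    simp [ho, leftSteps]
  rw [← h3]
  simpa only [Set.indicator_apply, Set.mem_ofPred_eq, Pi.one_apply] using h2

theorem sum_measure_hitsWith_le [IsProbabilityMeasure P] [IsProbabilityMeasure ν]
    (hX : IsRandomWalkInRandomEnv P ν env X) {n : ℕ} {z : ℕ → ℕ} (hz : z n = 0) :
    ∑' t, P {o | HitsWith n z t fun s => X s o} ≤
      ∏ x ∈ Finset.range n, branchingKernel ν (z (x + 1)) {z x} := by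
  have key : ∀ N : ℕ, ∑ t ∈ Finset.range (N + 1), P {o | HitsWith n z t fun s => X s o} +
      pendingProb P env X n z N ≤
        ∏ x ∈ Finset.range n, branchingKernel ν (z (x + 1)) {z x} := by
    intro N
    induction N with
    | zero => simpa using hX.measure_hitsWith_zero_add_le hz
    | succ N ih =>
      rw [Finset.sum_range_succ, add_assoc]
      exact (add_le_add le_rfl (hX.measure_hitsWith_succ_add_le hz N)).trans ih
  rw [ENNReal.tsum_eq_iSup_nat]
  refine iSup_le fun N => le_trans ?_ (le_self_add.trans (key N))
  exact Finset.sum_le_sum_of_subset (Finset.range_subset_range.2 N.le_succ)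

theorem measure_leftStepsUntilHit_eq_le [IsProbabilityMeasure P] [IsProbabilityMeasure ν]
    (hX : IsRandomWalkInRandomEnv P ν env X) (hρ : Integrable rho ν) (h1 : ∫ a, rho a ∂ν < 1)
    {n : ℕ} {z : ℕ → ℕ} (hz : z n = 0) :
    P {o | ∀ x < n, leftStepsUntilHit (fun t => X t o) n (x : ℕ) = z x} ≤
      ∏ x ∈ Finset.range n, branchingKernel ν (z (x + 1)) {z x} := by
  refine le_trans ?_ ((measure_iUnion_le _).trans (hX.sum_measure_hitsWith_le hz))
  refine measure_mono_ae ?_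
  -- `hittingTime` is `0` by default on paths that miss `n`; these are negligible.
  filter_upwards [hX.ae_exists_eq hρ h1 n] with o ho hL
  refine Set.mem_iUnion.2 ⟨hittingTime (fun t => X t o) n, fun s hs => ?_, ?_, hL⟩
  · exact Nat.notMem_of_lt_sInf hs
  · exact Nat.sInf_mem ho

/-- The law of `leftStepsVec n` under the annealed law is dominated by the law of the first `n`
steps of the branching process started at `0`. -/
theorem measure_leftStepsVec_le [IsProbabilityMeasure P] [IsProbabilityMeasure ν]
    (hX : IsRandomWalkInRandomEnv P ν env X) (hρ : Integrable rho ν) (h1 : ∫ a, rho a ∂ν < 1)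
    (n : ℕ) (A : Set (Fin n → ℕ)) :
    P {o | leftStepsVec n (fun t => X t o) ∈ A} ≤
      chainExp (branchingKernel ν) n 0 (A.indicator 1) := by
  have hsub : {o | leftStepsVec n (fun t => X t o) ∈ A} ⊆
      ⋃ y : Fin n → ℕ, {o | y ∈ A ∧ leftStepsVec n (fun t => X t o) = y} := fun o ho =>
    Set.mem_iUnion.2 ⟨_, ho, rfl⟩
  refine (measure_mono hsub).trans ((measure_iUnion_le _).trans (ENNReal.tsum_le_tsum fun y => ?_))
  by_cases hy : y ∈ A
  · simp only [hy, true_and, Set.indicator_of_mem, Pi.one_apply, one_mul]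
    -- Time is reversed: site `x` carries generation `n - 1 - x`, and `z n = 0` is the initial state
    -- of the branching process.
    set z : ℕ → ℕ := fun x => if h : x < n then y ⟨n - 1 - x, by omega⟩ else 0 with hz
    have hzn : z n = 0 := by simp [hz]
    refine le_trans (measure_mono fun o ho => ?_)
      ((hX.measure_leftStepsUntilHit_eq_le hρ h1 hzn).trans (le_of_eq ?_))
    · intro x hx
      have := congrFun ho ⟨n - 1 - x, by omega⟩
      simp only [hz, dif_pos hx, ← this, leftStepsVec]
      congr 2
      omega
    · rw [← Finset.prod_range_reflect, Finset.prod_range]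
      refine Finset.prod_congr rfl fun i _ => ?_
      have hi := i.2
      have h2 : z (n - 1 - i) = y i := by
        simp only [hz]
        rw [dif_pos (by omega)]
        congr 1
        ext
        simp only
        omega
      have h3 : z (n - 1 - i + 1) = (Fin.cons 0 y : Fin (n + 1) → ℕ) i.castSucc := by
        rcases i with ⟨_ | i, hi⟩
        · have : n - 1 - 0 + 1 = n := by omega
          simp only [this, hzn]
          rfl
        · have : n - 1 - (i + 1) + 1 = n - 1 - i := by omega
          simp only [this, hz]
          rw [dif_pos (by omega)]
          change _ = y ⟨i, by omega⟩
          congr 1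
          ext
          simp only
          omega
      rw [h2, h3]
  · simp [hy]

end IsRandomWalkInRandomEnv

theorem leftStepsUntilHit_self (w : ℕ → ℤ) (n : ℕ) : leftStepsUntilHit w n (n : ℤ) = 0 := by
  unfold leftStepsUntilHit leftSteps
  rw [Finset.card_eq_zero, Finset.filter_eq_empty_iff]
  rintro s hs ⟨h, -⟩
  exact Nat.notMem_of_lt_sInf (Finset.mem_range.1 hs) h

theorem sum_leftStepsUntilHit_eq_chainSum (g : ℕ → ℕ → ℝ) (w : ℕ → ℤ) (n : ℕ) :
    ∑ x ∈ Finset.range n, g (leftStepsUntilHit w n ((x : ℤ) + 1)) (leftStepsUntilHit w n (x : ℤ)) =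
      chainSum g n 0 (leftStepsVec n w) := by
  rw [← Finset.sum_range_reflect, Finset.sum_range, chainSum]
  refine Finset.sum_congr rfl fun i _ => ?_
  congr 1
  rcases i with ⟨_ | i, hi⟩
  · have : ((n - 1 - 0 : ℕ) : ℤ) + 1 = n := by omega
    rw [this, leftStepsUntilHit_self]
    rfl
  · change _ = leftStepsUntilHit w n ((n - 1 - i : ℕ) : ℤ)
    congr 1
    simp only
    omega

/-! ### Law of large numbers for functionals of linear growth -/

/-- The departure states are the arrival states shifted by one, with `0` in front and the last one
dropped. Thus sums over departures need no separate estimate. -/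
theorem sum_cons_zero_castSucc_le {u : ℕ → ℝ} (hu : u 0 = 0) (hu0 : ∀ x, 0 ≤ u x) {n : ℕ}
    (y : Fin n → ℕ) :
    ∑ i : Fin n, u ((Fin.cons 0 y : Fin (n + 1) → ℕ) i.castSucc) ≤ ∑ i, u (y i) := by
  have h1 := Fin.sum_univ_castSucc fun i => u ((Fin.cons 0 y : Fin (n + 1) → ℕ) i)
  have h2 := Fin.sum_univ_succ fun i => u ((Fin.cons 0 y : Fin (n + 1) → ℕ) i)
  simp only [Fin.cons_zero, Fin.cons_succ, hu, zero_add] at h2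
  linarith [hu0 ((Fin.cons 0 y : Fin (n + 1) → ℕ) (Fin.last n))]

/-- The excess of `x` over `K`. -/
def excess (K x : ℕ) : ℝ := ((x - K : ℕ) : ℝ)

theorem excess_nonneg (K x : ℕ) : 0 ≤ excess K x := Nat.cast_nonneg _

theorem excess_le (K x : ℕ) : excess K x ≤ x := Nat.cast_le.2 (Nat.sub_le _ _)

theorem excess_increments (K x : ℕ) : |excess K (x + 1) - excess K x| ≤ 1 := by
  unfold excess
  rcases Nat.lt_or_ge x K with h | h
  · have h1 : x + 1 - K = 0 := by omega
    have h2 : x - K = 0 := by omega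
    simp [h1, h2]
  · have h1 : x + 1 - K = x - K + 1 := by omega
    simp [h1]

theorem tendsto_integral_excess {π : Measure ℕ} (hπ : Integrable (fun x : ℕ => (x : ℝ)) π) :
    Tendsto (fun K => ∫ x, excess K x ∂π) atTop (𝓝 0) := by
  have h := tendsto_integral_of_dominated_convergence (μ := π) (F := fun K x => excess K x)
    (f := fun _ => (0 : ℝ)) (fun x : ℕ => (x : ℝ))
    (fun K => Measurable.of_discrete.aestronglyMeasurable) hπ
    (fun K => ae_of_all _ fun x => by
      rw [Real.norm_of_nonneg (excess_nonneg K x)]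
      exact excess_le K x)
    (ae_of_all _ fun x => tendsto_const_nhds.congr' (by
      filter_upwards [eventually_ge_atTop x] with K hK
      simp [excess, Nat.sub_eq_zero_of_le hK]))
  simpa using h

/-- The function `g` set to zero outside `[0, 2 K)²`. -/
def truncate (g : ℕ → ℕ → ℝ) (K x y : ℕ) : ℝ := if x < 2 * K ∧ y < 2 * K then g x y else 0

theorem abs_truncate_le {g : ℕ → ℕ → ℝ} {C : ℝ} (hC : 0 ≤ C)
    (hg : ∀ x y : ℕ, |g x y| ≤ C * (1 + x + y)) (K x y : ℕ) :
    |truncate g K x y| ≤ C * (1 + 2 * K + 2 * K) := by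
  unfold truncate
  split_ifs with h
  · refine (hg x y).trans ?_
    have h1 : (x : ℝ) ≤ 2 * K := by exact_mod_cast h.1.le
    have h2 : (y : ℝ) ≤ 2 * K := by exact_mod_cast h.2.le
    gcongr
  · rw [abs_zero]
    positivity

/-- Outside the square the larger coordinate `M` is at least `2 K`, so `M ≤ 2 (M - K)` and `1 ≤ M -
K`; linear growth is then controlled by the excess over `K`. -/
theorem abs_sub_truncate_le {g : ℕ → ℕ → ℝ} {C : ℝ} (hC : 0 ≤ C)
    (hg : ∀ x y : ℕ, |g x y| ≤ C * (1 + x + y)) {K : ℕ} (hK : 1 ≤ K) (x y : ℕ) :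
    |g x y - truncate g K x y| ≤ 6 * C * (excess K x + excess K y) := by
  unfold truncate
  split_ifs with h
  · rw [sub_self, abs_zero]
    have := excess_nonneg K x
    have := excess_nonneg K y
    positivity
  · rw [sub_zero]
    refine (hg x y).trans ?_
    have h1 : 1 + x + y ≤ 6 * ((x - K) + (y - K)) := by omega
    have h2 : (1 + x + y : ℝ) ≤ 6 * (excess K x + excess K y) := by
      unfold excess
      exact_mod_cast h1
    calc C * (1 + x + y) ≤ C * (6 * (excess K x + excess K y)) := by gcongr
      _ = _ := by ring

theorem chainSum_const_sub (g : ℕ → ℕ → ℝ) (c : ℝ) (n x : ℕ) (y : Fin n → ℕ) :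
    chainSum (fun a b => g a b - c) n x y = chainSum g n x y - n * c := by
  simp [chainSum, Finset.sum_sub_distrib]

theorem abs_chainSum_sub_truncate_le {g : ℕ → ℕ → ℝ} {C : ℝ} (hC : 0 ≤ C)
    (hg : ∀ x y : ℕ, |g x y| ≤ C * (1 + x + y)) {K : ℕ} (hK : 1 ≤ K) (n : ℕ) (y : Fin n → ℕ) :
    |chainSum g n 0 y - chainSum (truncate g K) n 0 y| ≤
      12 * C * chainSum (fun _ => excess K) n 0 y := by
  unfold chainSum
  rw [← Finset.sum_sub_distrib]
  refine (Finset.abs_sum_le_sum_abs _ _).trans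
    ((Finset.sum_le_sum fun i _ => abs_sub_truncate_le hC hg hK _ _).trans ?_)
  rw [← Finset.mul_sum, Finset.sum_add_distrib]
  have h := sum_cons_zero_castSucc_le (u := excess K) (by simp [excess]) (excess_nonneg K) y
  have := mul_le_mul_of_nonneg_left h hC
  linarith

theorem map_fst_pairLaw {π : Measure ℕ} [SFinite π] {ν : Measure (Set.Ioo (0 : ℝ) 1)}
    [IsProbabilityMeasure ν] : (pairLaw π ν).map Prod.fst = π :=
  Measure.fst_compProd π _

theorem map_snd_pairLaw {π : Measure ℕ} [SFinite π] {ν : Measure (Set.Ioo (0 : ℝ) 1)}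
    [IsProbabilityMeasure ν] (hπ : Kernel.Invariant (branchingKernel ν) π) :
    (pairLaw π ν).map Prod.snd = π :=
  (Measure.snd_compProd π _).trans hπ

/-! ### Integration against the stationary pair law -/

section PairLaw

variable {π : Measure ℕ} {ν : Measure (Set.Ioo (0 : ℝ) 1)} [IsProbabilityMeasure ν]

instance [IsProbabilityMeasure π] : IsProbabilityMeasure (pairLaw π ν) := by
  unfold pairLaw
  infer_instance

theorem integrable_fst_pairLaw [SFinite π] {h : ℕ → ℝ} (hh : Integrable h π) :
    Integrable (fun z : ℕ × ℕ => h z.1) (pairLaw π ν) := by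
  rw [← map_fst_pairLaw (π := π) (ν := ν)] at hh
  exact hh.comp_measurable measurable_fst

theorem integrable_snd_pairLaw [SFinite π] (hπ : Kernel.Invariant (branchingKernel ν) π) {h : ℕ → ℝ}
    (hh : Integrable h π) : Integrable (fun z : ℕ × ℕ => h z.2) (pairLaw π ν) := by
  rw [← map_snd_pairLaw hπ] at hh
  exact hh.comp_measurable measurable_snd

theorem integral_fst_pairLaw [SFinite π] (h : ℕ → ℝ) :
    ∫ z : ℕ × ℕ, h z.1 ∂(pairLaw π ν) = ∫ x, h x ∂π := by
  conv_rhs => rw [← map_fst_pairLaw (π := π) (ν := ν)]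
  exact (integral_map measurable_fst.aemeasurable
    Measurable.of_discrete.aestronglyMeasurable).symm

theorem integral_snd_pairLaw [SFinite π] (hπ : Kernel.Invariant (branchingKernel ν) π) (h : ℕ → ℝ) :
    ∫ z : ℕ × ℕ, h z.2 ∂(pairLaw π ν) = ∫ x, h x ∂π := by
  conv_rhs => rw [← map_snd_pairLaw hπ]
  exact (integral_map measurable_snd.aemeasurable
    Measurable.of_discrete.aestronglyMeasurable).symm

theorem integrable_pairLaw [IsProbabilityMeasure π]
    (hπ : Kernel.Invariant (branchingKernel ν) π)
    (hint : Integrable (fun x : ℕ => (x : ℝ)) π) {g : ℕ → ℕ → ℝ} {C : ℝ}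
    (hg : ∀ x y : ℕ, |g x y| ≤ C * (1 + x + y)) :
    Integrable (fun z : ℕ × ℕ => g z.1 z.2) (pairLaw π ν) :=
  ((((integrable_const (1 : ℝ)).add (integrable_fst_pairLaw hint)).add
    (integrable_snd_pairLaw hπ hint)).const_mul C).mono'
    Measurable.of_discrete.aestronglyMeasurable (ae_of_all _ fun z => hg z.1 z.2)

theorem abs_integral_pairLaw_sub_truncate_le [IsProbabilityMeasure π]
    (hπ : Kernel.Invariant (branchingKernel ν) π)
    (hint : Integrable (fun x : ℕ => (x : ℝ)) π) {g : ℕ → ℕ → ℝ} {C : ℝ} (hC : 0 ≤ C)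
    (hg : ∀ x y : ℕ, |g x y| ≤ C * (1 + x + y)) {K : ℕ} (hK : 1 ≤ K) :
    |∫ z, g z.1 z.2 ∂(pairLaw π ν) - ∫ z, truncate g K z.1 z.2 ∂(pairLaw π ν)| ≤
      12 * C * ∫ x, excess K x ∂π := by
  have hu : Integrable (excess K) π := integrable_of_increments (excess_increments K) hint
  have e : 12 * C * ∫ x, excess K x ∂π =
      ∫ z, 6 * C * (excess K z.1 + excess K z.2) ∂(pairLaw π ν) := by
    rw [integral_const_mul, integral_add (integrable_fst_pairLaw hu)
      (integrable_snd_pairLaw hπ hu), integral_fst_pairLaw, integral_snd_pairLaw hπ]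
    ring
  rw [e, ← integral_sub (integrable_pairLaw hπ hint hg)
    (integrable_of_abs_le (fun z => abs_truncate_le hC hg K z.1 z.2) _), ← Real.norm_eq_abs]
  exact norm_integral_le_of_norm_le (((integrable_fst_pairLaw hu).add
    (integrable_snd_pairLaw hπ hu)).const_mul _)
    (ae_of_all _ fun z => abs_sub_truncate_le hC hg hK z.1 z.2)

end PairLaw

/-- Chebyshev's inequality for the truncated functional and Markov's inequality for the rest. -/
theorem indicator_deviation_le {g : ℕ → ℕ → ℝ} {C ε c c' : ℝ} (hC : 0 ≤ C) (hε : 0 < ε)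
    (hg : ∀ x y : ℕ, |g x y| ≤ C * (1 + x + y)) {K : ℕ} (hK : 1 ≤ K) (hc : |c - c'| ≤ ε / 3)
    {n : ℕ} (hn : 0 < n) (y : Fin n → ℕ) :
    {y : Fin n → ℕ | ε ≤ dist (chainSum g n 0 y / n) c}.indicator (1 : (Fin n → ℕ) → ℝ≥0∞) y ≤
      ENNReal.ofReal (9 / (ε * n) ^ 2) *
          ENNReal.ofReal (chainSum (fun a b => truncate g K a b - c') n 0 y ^ 2) +
        ENNReal.ofReal (36 * C / (ε * n)) *
          ENNReal.ofReal (chainSum (fun _ => excess K) n 0 y) := by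
  by_cases hy : ε ≤ dist (chainSum g n 0 y / n) c
  swap
  · rw [Set.indicator_of_notMem (by exact hy)]
    exact zero_le
  rw [Set.indicator_of_mem (by exact hy)]
  have hn' : (0 : ℝ) < n := Nat.cast_pos.2 hn
  have hu0 : 0 ≤ chainSum (fun _ => excess K) n 0 y := Finset.sum_nonneg fun i _ =>
    excess_nonneg K _
  have h1 : ε * n ≤ |chainSum g n 0 y - n * c| := by
    have e : chainSum g n 0 y - n * c = (chainSum g n 0 y / n - c) * n := by
      field_simp
    rw [e, abs_mul, abs_of_pos hn', ← Real.dist_eq]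
    exact mul_le_mul_of_nonneg_right hy hn'.le
  have h2 := abs_chainSum_sub_truncate_le hC hg hK n y
  have h3 : |(n : ℝ) * c' - n * c| ≤ ε * n / 3 := by
    rw [← mul_sub, abs_mul, abs_of_pos hn', abs_sub_comm]
    have := mul_le_mul_of_nonneg_left hc hn'.le
    linarith
  rw [chainSum_const_sub]
  set s := chainSum g n 0 y
  set s' := chainSum (truncate g K) n 0 y
  set u := chainSum (fun _ => excess K) n 0 y
  have h4 : |s - n * c| ≤ |s - s'| + |s' - n * c'| + |(n : ℝ) * c' - n * c| := by
    have i1 := abs_add_le (s - s' + (s' - n * c')) (n * c' - n * c)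
    have i2 := abs_add_le (s - s') (s' - n * c')
    have e : s - s' + (s' - n * c') + (n * c' - n * c) = s - n * c := by ring
    rw [e] at i1
    linarith
  rw [← ENNReal.ofReal_mul (by positivity), ← ENNReal.ofReal_mul (by positivity),
    ← ENNReal.ofReal_add (by positivity) (by positivity), Pi.one_apply, ENNReal.one_le_ofReal]
  have hεn : 0 < ε * n := by positivity
  have q2 : 0 ≤ 36 * C / (ε * n) * u := by positivity
  -- The deviation `ε n` is split in thirds. Recentring uses at most one, so either the truncated
  -- sum (hence `9 = 3 ^ 2`) or the remainder (hence `36 = 3 * 12`) accounts for another.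
  by_cases h5 : ε * n / 3 ≤ |s' - n * c'|
  · have h6 : (ε * n / 3) ^ 2 ≤ (s' - n * c') ^ 2 := by
      rw [← sq_abs (s' - n * c')]
      exact pow_le_pow_left₀ (by positivity) h5 2
    have h7 : 1 ≤ 9 / (ε * n) ^ 2 * (s' - n * c') ^ 2 := by
      rw [div_mul_eq_mul_div, one_le_div (by positivity)]
      linarith
    linarith
  · have h7 : 1 ≤ 36 * C / (ε * n) * u := by
      rw [div_mul_eq_mul_div, one_le_div (by positivity)]
      linarith
    have : 0 ≤ 9 / (ε * n) ^ 2 * (s' - n * c') ^ 2 := by positivity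
    linarith

namespace IsRandomWalkInRandomEnv

variable {Ω : Type*} {X : ℕ → Ω → ℤ} [MeasurableSpace Ω] {P : Measure Ω} [IsProbabilityMeasure P]
  {ν : Measure (Set.Ioo (0 : ℝ) 1)} [IsProbabilityMeasure ν] {env : Ω → Env}

/-- The truncation level is fixed first, making the remainder small on average uniformly in large
`n`; then the variance of the truncated average, of order `1 / n`, tends to zero. -/
theorem tendstoInMeasure_average (hX : IsRandomWalkInRandomEnv P ν env X) (hρ : Integrable rho ν)
    (h1 : ∫ a, rho a ∂ν < 1) {π : Measure ℕ} [IsProbabilityMeasure π]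
    (hπ : Kernel.Invariant (branchingKernel ν) π) {g : ℕ → ℕ → ℝ} {C : ℝ} (hC : 0 ≤ C)
    (hg : ∀ x y : ℕ, |g x y| ≤ C * (1 + x + y)) :
    TendstoInMeasure P (fun (n : ℕ) o => (∑ x ∈ Finset.range n,
        g (leftStepsUntilHit (fun t => X t o) n ((x : ℤ) + 1))
          (leftStepsUntilHit (fun t => X t o) n (x : ℤ))) / n) atTop
      (fun _ => ∫ z, g z.1 z.2 ∂(pairLaw π ν)) := by
  have hκ := isContracting_branchingKernel hρ h1
  have hint := hκ.integrable_natCast_invariant hπ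
  set m := ∫ a, rho a ∂ν
  set c := ∫ z, g z.1 z.2 ∂(pairLaw π ν) with hc
  set μ₁ := ∫ x : ℕ, (x : ℝ) ∂π
  simp_rw [sum_leftStepsUntilHit_eq_chainSum]
  refine tendstoInMeasure_iff_dist.2 fun ε hε => ?_
  have key : ∀ δ : ℝ, 0 < δ → ∀ᶠ n : ℕ in atTop,
      P {o | ε ≤ dist (chainSum g n 0 (leftStepsVec n fun t => X t o) / n) c} ≤
        ENNReal.ofReal δ := by
    intro δ hδ
    have hv := tendsto_integral_excess hint
    -- `ev1` keeps the recentring error below `ε / 3`; `ev2` keeps the limiting Markov bound for the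
    -- remainder below `δ / 2`.
    have ev1 : ∀ᶠ K in atTop, 12 * C * ∫ x, excess K x ∂π < ε / 3 := by
      have := hv.const_mul (12 * C)
      rw [mul_zero] at this
      exact this.eventually_lt_const (by positivity)
    have ev2 : ∀ᶠ K in atTop, 36 * C / ε * ∫ x, excess K x ∂π < δ / 2 := by
      have := hv.const_mul (36 * C / ε)
      rw [mul_zero] at this
      exact this.eventually_lt_const (by positivity)
    obtain ⟨K, hK1, hK2, hK⟩ := (ev1.and (ev2.and (eventually_ge_atTop 1))).exists
    set v := ∫ x, excess K x ∂π
    set c' := ∫ z, truncate g K z.1 z.2 ∂(pairLaw π ν) with hc'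
    have hcc : |c - c'| ≤ ε / 3 :=
      (abs_integral_pairLaw_sub_truncate_le hπ hint hC hg hK).trans hK1.le
    have hbdd := abs_truncate_le hC hg K
    have hc'' : c' = ∫ x, ∫ y, truncate g K x y ∂(branchingKernel ν x) ∂π := by
      rw [hc', pairLaw, Measure.integral_compProd]
      exact integrable_of_abs_le (fun z => hbdd z.1 z.2) (pairLaw π ν)
    have hcent : ∫ x, ∫ y, (truncate g K x y - c') ∂(branchingKernel ν x) ∂π = 0 := by
      have e : ∀ x, ∫ y, (truncate g K x y - c') ∂(branchingKernel ν x) =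
          ∫ y, truncate g K x y ∂(branchingKernel ν x) - c' := fun x => by
        rw [integral_sub (integrable_of_abs_le (hbdd x) _) (integrable_const _)]
        simp
      simp_rw [e]
      rw [integral_sub (integrable_of_abs_le (fun x => abs_integral_le (hbdd x) _) _)
        (integrable_const _), ← hc'']
      simp
    obtain ⟨α, hα0, hα⟩ := hκ.exists_chainExp_sq_le hπ (g := fun x y => truncate g K x y - c')
      (B := C * (1 + 2 * K + 2 * K) + |c'|)
      (fun x y => (abs_sub _ _).trans (add_le_add (hbdd x y) le_rfl)) hcent
    have hlim : Tendsto (fun n : ℕ => 9 * α / ε ^ 2 / n + (36 * C / ε * v +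
        36 * C / ε * (m * 1 / (1 - m) * μ₁) / n)) atTop (𝓝 (0 + (36 * C / ε * v + 0))) :=
      (tendsto_const_div_atTop_nhds_zero_nat _).add
        ((tendsto_const_div_atTop_nhds_zero_nat _).const_add _)
    have hlt : 0 + (36 * C / ε * v + 0) < δ := by linarith
    filter_upwards [hlim.eventually_lt_const hlt, eventually_gt_atTop 0] with n hn hn0
    have hn' : (0 : ℝ) < n := Nat.cast_pos.2 hn0
    refine (hX.measure_leftStepsVec_le hρ h1 n
      {y | ε ≤ dist (chainSum g n 0 y / n) c}).trans ?_
    refine (chainExp_mono _ n 0 fun y =>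
      indicator_deviation_le hC hε hg hK hcc hn0 y).trans ?_
    rw [chainExp_add, chainExp_const_mul, chainExp_const_mul]
    have b1 := hα n
    have b2 := hκ.chainExp_sum_le hπ (excess_increments K) (excess_nonneg K) n
    have hm := hκ.nonneg
    have hm1 := hκ.one_sub_pos
    have hμ₁ : 0 ≤ μ₁ := integral_nonneg fun x => by positivity
    have hv0 : 0 ≤ v := integral_nonneg fun x => excess_nonneg K x
    refine (add_le_add (mul_le_mul_right b1 _) (mul_le_mul_right b2 _)).trans ?_
    rw [← ENNReal.ofReal_mul (by positivity), ← ENNReal.ofReal_mul (by positivity)]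
    have e1 : 9 / (ε * n) ^ 2 * (α * n) = 9 * α / ε ^ 2 / n := by field_simp
    have e2 : 36 * C / (ε * n) * (n * v + m * 1 / (1 - m) * μ₁) =
        36 * C / ε * v + 36 * C / ε * (m * 1 / (1 - m) * μ₁) / n := by field_simp
    rw [e1, e2, ← ENNReal.ofReal_add (by positivity) (by positivity)]
    exact ENNReal.ofReal_le_ofReal hn.le
  refine ENNReal.tendsto_nhds_zero.2 fun δ hδ => ?_
  rcases eq_or_ne δ ∞ with rfl | hδ'
  · exact Eventually.of_forall fun n => le_top
  · have := key δ.toReal (ENNReal.toReal_pos hδ.ne' hδ')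
    rwa [ENNReal.ofReal_toReal hδ'] at this

end IsRandomWalkInRandomEnv

end RWRE

/-! ### Application to the criterion and its suprema -/

theorem theorem3 {d : ℕ} (Θ : Set (EuclideanSpace ℝ (Fin d))) (hΘ : IsCompact Θ)
    (ν : Θ → Measure (Set.Ioo (0 : ℝ) 1)) [∀ θ, IsProbabilityMeasure (ν θ)]
    -- transience to the right
    (h_trans : ∀ θ, Integrable (fun a => Real.log (RWRE.rho a)) (ν θ) ∧
      ∫ a, Real.log (RWRE.rho a) ∂(ν θ) < 0)
    -- ballistic case
    (h_ball : ∀ θ, Integrable RWRE.rho (ν θ) ∧ ∫ a, RWRE.rho a ∂(ν θ) < 1)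
    -- continuity
    (h_cont : ∀ x y : ℕ, Continuous (fun θ => RWRE.phi (ν θ) x y))
    -- identifiability
    (h_ident : ∀ θ θ', ν θ ≠ ν θ' ↔ θ ≠ θ')
    -- uniform lower bound on the mean of `log (1 - ω_0)`
    (h_below : ∃ C : ℝ, ∀ θ, Integrable (fun a : Set.Ioo (0 : ℝ) 1 => Real.log (1 - (a : ℝ))) (ν θ) ∧
      C ≤ ∫ a, Real.log (1 - (a : ℝ)) ∂(ν θ))
    -- the true parameter, and the walk observed under it
    (θ₀ : Θ) (hθ₀ : (θ₀ : EuclideanSpace ℝ (Fin d)) ∈ interior Θ)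
    {Ω : Type*} [MeasurableSpace Ω] (P : Measure Ω) [IsProbabilityMeasure P]
    (env : Ω → RWRE.Env) (X : ℕ → Ω → ℤ)
    (hX : RWRE.IsRandomWalkInRandomEnv P (ν θ₀) env X) :
    (∃! π : Measure ℕ, IsProbabilityMeasure π ∧
      Kernel.Invariant (RWRE.branchingKernel (ν θ₀)) π) ∧
    ∀ π : Measure ℕ, IsProbabilityMeasure π →
      Kernel.Invariant (RWRE.branchingKernel (ν θ₀)) π →
      (∀ θ : Θ,
        Integrable (fun z : ℕ × ℕ => RWRE.phi (ν θ) z.1 z.2) (RWRE.pairLaw π (ν θ₀)) ∧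
        TendstoInMeasure P
          (fun (n : ℕ) o => RWRE.criterion (ν θ) n (fun t => X t o) / n) atTop
          (fun _ => ∫ z, RWRE.phi (ν θ) z.1 z.2 ∂(RWRE.pairLaw π (ν θ₀)))) ∧
      (∀ U : Set Θ, IsOpen U → U.Nonempty →
        (∀ x y : ℕ, BddAbove (Set.range (fun θ : U => RWRE.phi (ν θ) x y))) ∧
        Integrable (fun z : ℕ × ℕ => ⨆ θ : U, RWRE.phi (ν θ) z.1 z.2)
          (RWRE.pairLaw π (ν θ₀)) ∧
        TendstoInMeasure P
          (fun (n : ℕ) o => (∑ x ∈ Finset.range n, ⨆ θ : U,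
            RWRE.phi (ν θ)
              (RWRE.leftStepsUntilHit (fun t => X t o) n ((x : ℤ) + 1))
              (RWRE.leftStepsUntilHit (fun t => X t o) n (x : ℤ))) / n) atTop
          (fun _ => ∫ z, (⨆ θ : U, RWRE.phi (ν θ) z.1 z.2)
            ∂(RWRE.pairLaw π (ν θ₀)))) := by
  obtain ⟨C, hC⟩ := h_below
  have hφ0 : ∀ (θ : Θ) (x y : ℕ), RWRE.phi (ν θ) x y ≤ 0 := fun θ x y => RWRE.phi_nonpos x y
  have hφ1 : ∀ (θ : Θ) (x y : ℕ), -(|C| * (1 + x + y)) ≤ RWRE.phi (ν θ) x y := by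
    intro θ x y
    refine le_trans ?_ (RWRE.le_phi (h_trans θ).1 (h_trans θ).2 (hC θ).1 (hC θ).2 x y)
    rw [← neg_mul]
    exact mul_le_mul_of_nonneg_right (neg_abs_le C) (by positivity)
  have hκ := RWRE.isContracting_branchingKernel (h_ball θ₀).1 (h_ball θ₀).2
  obtain ⟨π₀, hπ₀, hinv₀⟩ := hκ.exists_invariant
  refine ⟨⟨π₀, ⟨hπ₀, hinv₀⟩, fun π hπ => ?_⟩, fun π hπ hinv => ⟨fun θ => ?_, fun U _ hU => ?_⟩⟩
  · have := hπ.1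
    exact hκ.invariant_unique hπ.2 hinv₀
  · have hg : ∀ x y : ℕ, |RWRE.phi (ν θ) x y| ≤ |C| * (1 + x + y) := fun x y =>
      abs_le.2 ⟨hφ1 θ x y, (hφ0 θ x y).trans (by positivity)⟩
    exact ⟨RWRE.integrable_pairLaw hinv (hκ.integrable_natCast_invariant hinv) hg,
      hX.tendstoInMeasure_average (h_ball θ₀).1 (h_ball θ₀).2 hinv (abs_nonneg C) hg⟩
  · have hbdd : ∀ x y : ℕ, BddAbove (Set.range fun θ : U => RWRE.phi (ν θ) x y) := fun x y =>
      ⟨0, Set.forall_mem_range.2 fun θ => hφ0 θ x y⟩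
    have hne : Nonempty U := hU.to_subtype
    -- The constant is the same for all `θ`, so one parameter of `U` gives the lower bound of the
    -- supremum.
    have hg : ∀ x y : ℕ, |⨆ θ : U, RWRE.phi (ν θ) x y| ≤ |C| * (1 + x + y) := fun x y =>
      abs_le.2 ⟨(hφ1 _ x y).trans (le_ciSup (hbdd x y) hne.some),
        (ciSup_le fun θ : U => hφ0 θ x y).trans (by positivity)⟩
    exact ⟨hbdd, RWRE.integrable_pairLaw hinv (hκ.integrable_natCast_invariant hinv) hg,
      hX.tendstoInMeasure_average (g := fun x y => ⨆ θ : U, RWRE.phi (ν θ) x y)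
        (h_ball θ₀).1 (h_ball θ₀).2 hinv (abs_nonneg C) hg⟩
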